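/- Let $\mathbb R^4_1=\mathbb R^3\times\mathbb R$ carry the Lorentz product $\langle u,v\rangle=u_1v_1+u_2v_2+u_3v_3-u_4v_4$; the point $(c,r)$ is identified with the oriented sphere of $\mathbb R^3$ with center $c$ and signed radius $r$, and a contact element $(x,\nu)\in\mathbb R^3\times S^2$ with the null line $[x,\nu]=\{(x-t\nu,t):t\in\mathbb R\}$ of spheres in oriented contact with it. Let $M$ be a smooth surface. A Legendre immersion is a smooth immersion $(f,n):V\to\mathbb R^3\times S^2$, $V\subseteq M$ open, with $df\cdot n=0$; its third and second fundamental forms are $\mathrm{III}=dn\cdot dn$ and $\mathrm{II}=-df\cdot dn$, and its curvature directions are the eigendirections of $\mathrm{II}$ with respect to $\mathrm{III}$. It envelopes $S:M\to\mathbb R^4_1$ over $V$ if $S(q)\in[f(q),n(q)]$ for all $q\in V$. A space-like immersion (an immersion whose induced metric is positive definite) has locally exactly two envelopes $(f,n)$, $(\hat f,\hat n)$. A Darboux sphere congruence is a smooth space-like immersion $S:M\to\mathbb R^4_1$ such that near every point the third fundamental forms of its two envelopes are positive definite and conformal to each other (one is a positive multiple of the other at each point), and the lines of curvature correspond, i.e.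 at each point some basis of the tangent plane consists of curvature directions common to both envelopes. It is nondegenerate if there is no nonempty open set $V\subseteq M$ over which the two envelopes both (i) are Laguerre equivalent, i.e. some isometry $x\mapsto Ax+b$ of $\mathbb R^4_1$ maps $[f(q),n(q)]$ onto $[\hat f(q),\hat n(q)]$ for all $q\in V$, and (ii) have the same orientation at every point of $V$, i.e. $dn$ and $d\hat n$, each followed by orthogonal projection to the tangent plane $dS(T_qM)$, induce the same orientation on $T_qM$. **Theorem 2.** Let $S:M\to\mathbb R^4_1$ be a smooth map all of whose (local) envelopes have positive definite third fundamental form. Then $S$ is a nondegenerate Darboux sphere congruence if and only if $S$ is a space-like immersion whose induced metric is flat and whose normal bundle (with the normal connection) is flat. -/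

import Mathlib

open scoped Manifold ContDiff Topology

noncomputable section

namespace LaguerreGeom

/-- Euclidean 3-space. -/
abbrev E3 : Type := EuclideanSpace ℝ (Fin 3)

/-- The coordinate plane on which surfaces are modelled. -/
abbrev E2 : Type := EuclideanSpace ℝ (Fin 2)

/-- Minkowski 4-space, written as space times time.  The point `(c, r)` is also the oriented
sphere of `ℝ³` with center `c` and signed radius `r` (a point sphere if `r = 0`). -/
abbrev Mink : Type := E3 × ℝ

/-- The Lorentz scalar product `u₁v₁ + u₂v₂ + u₃v₃ - u₄v₄`. -/
def lor (u v : Mink) : ℝ := inner ℝ u.1 v.1 - u.2 * v.2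

/-- The null line `{(x - t n, t)}` of all oriented spheres that are in oriented contact with the
contact element `(x, n)`. -/
def contactLine (x n : E3) : Set Mink := {u | ∃ t : ℝ, u = (x - t • n, t)}

/-! ### Maps on a surface -/

section Surface

variable {M : Type*} [TopologicalSpace M] [ChartedSpace E2 M]

/-- The differential at `q`, in the direction `v`, of a map into a normed space. -/
def dMap {W : Type*} [NormedAddCommGroup W] [NormedSpace ℝ W] (F : M → W) (q : M)
    (v : TangentSpace (𝓡 2) q) : W :=
  mfderiv (𝓡 2) 𝓘(ℝ, W) F q v

/-- `S` is a smooth space-like immersion: its differential is injective and the induced metric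
is positive definite. -/
structure IsSpacelikeImmersion (S : M → Mink) : Prop where
  smooth : ContMDiff (𝓡 2) 𝓘(ℝ, Mink) ∞ S
  immersion : ∀ q : M, Function.Injective (dMap S q)
  spacelike : ∀ (q : M) (v : TangentSpace (𝓡 2) q), v ≠ 0 → 0 < lor (dMap S q v) (dMap S q v)

/-! ### Legendre immersions, third and second fundamental forms, curvature directions -/

/-- `(f, n)` is, on the open set `V`, a smooth Legendre immersion into the space `ℝ³ × S²` of
contact elements. The values of `f` and `n` outside `V` are irrelevant. -/
structure IsLegendreImmersionOn (V : Set M) (f n : M → E3) : Prop where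
  smooth_f : ContMDiffOn (𝓡 2) 𝓘(ℝ, E3) ∞ f V
  smooth_n : ContMDiffOn (𝓡 2) 𝓘(ℝ, E3) ∞ n V
  unit : ∀ q ∈ V, ‖n q‖ = 1
  contact : ∀ q ∈ V, ∀ v : TangentSpace (𝓡 2) q, inner ℝ (dMap f q v) (n q) = 0
  immersion : ∀ q ∈ V, ∀ v : TangentSpace (𝓡 2) q, v ≠ 0 → dMap f q v ≠ 0 ∨ dMap n q v ≠ 0

/-- The third fundamental form `dn · dn`. -/
def thirdForm (n : M → E3) (q : M) (v w : TangentSpace (𝓡 2) q) : ℝ :=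
  inner ℝ (dMap n q v) (dMap n q w)

/-- The second fundamental form `- df · dn`. -/
def secondForm (f n : M → E3) (q : M) (v w : TangentSpace (𝓡 2) q) : ℝ :=
  - inner ℝ (dMap f q v) (dMap n q w)

/-- The third fundamental form of `(f, n)` is positive definite at `q`. -/
def ThirdFormPosDef (n : M → E3) (q : M) : Prop :=
  ∀ v : TangentSpace (𝓡 2) q, v ≠ 0 → 0 < thirdForm n q v v

/-- `v` is a curvature direction of `(f, n)` at `q`: an eigendirection of the second
fundamental form with respect to the third. -/
def IsCurvatureDirection (f n : M → E3) (q : M) (v : TangentSpace (𝓡 2) q) : Prop :=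
  v ≠ 0 ∧ ∃ h : ℝ, ∀ w : TangentSpace (𝓡 2) q, secondForm f n q v w = h * thirdForm n q v w

/-! ### Envelopes -/

/-- The Legendre immersion `(f, n)`, defined on `V`, envelopes `S` over `V`: the sphere `S q` is
in oriented contact with the contact element `(f q, n q)`. -/
def Envelopes (V : Set M) (S : M → Mink) (f n : M → E3) : Prop :=
  IsLegendreImmersionOn V f n ∧ ∀ q ∈ V, S q ∈ contactLine (f q) (n q)

/-- `(f, n)` and `(f', n')` are the two (everywhere distinct) envelopes of `S` over the
open set `V`. -/
structure IsEnvelopePair (V : Set M) (S : M → Mink) (f n f' n' : M → E3) : Prop where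
  isOpen : IsOpen V
  fst : Envelopes V S f n
  snd : Envelopes V S f' n'
  distinct : ∀ q ∈ V, (f q, n q) ≠ (f' q, n' q)

/-- At `q` the correspondence of the two envelopes preserves the curvature directions: some basis
of the tangent plane consists of common curvature directions. (Unless one of the two has an
umbilic at `q`, this says that the curvature directions coincide.) -/
def PreservesCurvatureDirections (f n f' n' : M → E3) (q : M) : Prop :=
  ∃ v : Fin 2 → TangentSpace (𝓡 2) q, LinearIndependent ℝ v ∧
    ∀ i, IsCurvatureDirection f n q (v i) ∧ IsCurvatureDirection f' n' q (v i)

/-- At `q` the correspondence of the two envelopes is conformal with respect to the third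
fundamental forms. -/
def ConformalThirdForms (n n' : M → E3) (q : M) : Prop :=
  ThirdFormPosDef n q ∧ ThirdFormPosDef n' q ∧
    ∃ c : ℝ, 0 < c ∧ ∀ v w : TangentSpace (𝓡 2) q, thirdForm n' q v w = c * thirdForm n q v w

/-- `S` is a Darboux sphere congruence: a space-like immersion such that the correspondence of
its two envelopes (which in general exist as a labelled pair only locally) preserves the lines of
curvature and is conformal for the third fundamental forms. -/
def IsDarboux (S : M → Mink) : Prop :=
  IsSpacelikeImmersion S ∧
    ∀ p : M, ∃ (V : Set M) (f n f' n' : M → E3), p ∈ V ∧ IsEnvelopePair V S f n f' n' ∧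
      ∀ q ∈ V, PreservesCurvatureDirections f n f' n' q ∧ ConformalThirdForms n n' q

/-! ### Degenerate congruences -/

/-- The isometry `x ↦ A x + b` of Minkowski 4-space carries the contact elements
`(f, n)` to `(f', n')` over `V`, for some such isometry. -/
def LaguerreEquivalentOn (V : Set M) (f n f' n' : M → E3) : Prop :=
  ∃ (A : Mink →ₗ[ℝ] Mink) (b : Mink), (∀ u v, lor (A u) (A v) = lor u v) ∧
    ∀ q ∈ V, (fun u => A u + b) '' contactLine (f q) (n q) = contactLine (f' q) (n' q)

/-- `A v` is the tangent vector whose image under `dS` is the orthogonal projection, along the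
normal plane of `S`, of `dn(v) ∈ ℝ³ ⊆ ℝ⁴₁` to the tangent plane of `S`. -/
def IsGaussDifferential (S : M → Mink) (n : M → E3) (q : M)
    (A : TangentSpace (𝓡 2) q →ₗ[ℝ] TangentSpace (𝓡 2) q) : Prop :=
  ∀ v w : TangentSpace (𝓡 2) q, lor ((dMap n q v, 0) - dMap S q (A v)) (dMap S q w) = 0

/-- Two envelopes of `S` have the same orientation at `q`: their Gauss maps `n` and `n'`, with
`T_n S²` and `T_n' S²` both projected to the common tangent plane `dS (T_q M)`,
induce the same orientation. -/
def SameOrientationAt (S : M → Mink) (n n' : M → E3) (q : M) : Prop :=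
  ∃ A A' : TangentSpace (𝓡 2) q →ₗ[ℝ] TangentSpace (𝓡 2) q,
    IsGaussDifferential S n q A ∧ IsGaussDifferential S n' q A' ∧
      0 < LinearMap.det A * LinearMap.det A'

/-- `S` is degenerate somewhere: over some nonempty open set its two envelopes are
Laguerre equivalent and have the same orientation. -/
def DegenerateSomewhere (S : M → Mink) : Prop :=
  ∃ (V : Set M) (f n f' n' : M → E3), V.Nonempty ∧ IsEnvelopePair V S f n f' n' ∧
    LaguerreEquivalentOn V f n f' n' ∧ ∀ q ∈ V, SameOrientationAt S n n' q

/-- A nondegenerate Darboux sphere congruence. -/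
def IsNondegenerateDarboux (S : M → Mink) : Prop :=
  IsDarboux S ∧ ¬ DegenerateSomewhere S

/-- Every envelope of `S` (over any open set) has positive definite third fundamental form, that
is, has an immersive Gauss map. -/
def HasRegularEnvelopes (S : M → Mink) : Prop :=
  ∀ (V : Set M) (f n : M → E3), IsOpen V → Envelopes V S f n → ∀ q ∈ V, ThirdFormPosDef n q

end Surface

/-! ### Curvature of the induced metric and of the normal bundle, in coordinates -/

section Coordinates

/-- Partial derivative in the `i`-th coordinate direction. -/
def partialD {W : Type*} [NormedAddCommGroup W] [NormedSpace ℝ W] (i : Fin 2) (F : E2 → W)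
    (u : E2) : W :=
  fderiv ℝ F u (EuclideanSpace.single i (1 : ℝ))

/-- The Gram matrix `g_ij = ⟨∂_i s, ∂_j s⟩` of the metric induced by `s`. -/
def gram (s : E2 → Mink) (u : E2) : Matrix (Fin 2) (Fin 2) ℝ :=
  Matrix.of fun i j => lor (partialD i s u) (partialD j s u)

/-- The Christoffel symbol `Γ^l_ij` of the matrix-valued function `g`. -/
def christoffel (g : E2 → Matrix (Fin 2) (Fin 2) ℝ) (l i j : Fin 2) (u : E2) : ℝ :=
  ∑ k, (g u)⁻¹ l k * ((partialD i (fun x => g x j k) u + partialD j (fun x => g x i k) u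
    - partialD k (fun x => g x i j) u) / 2)

/-- The component `R^l_kij` of the Riemann curvature tensor of `g`, i.e. the `l`-th coordinate
of `R(∂_i, ∂_j) ∂_k`. -/
def riemannTensor (g : E2 → Matrix (Fin 2) (Fin 2) ℝ) (l k i j : Fin 2) (u : E2) : ℝ :=
  partialD i (christoffel g l j k) u - partialD j (christoffel g l i k) u
    + ∑ m, (christoffel g l i m u * christoffel g m j k u
      - christoffel g l j m u * christoffel g m i k u)

/-- Orthogonal projection of `v` to the normal plane of `s` at `u`. -/
def normalProj (s : E2 → Mink) (u : E2) (v : Mink) : Mink :=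
  v - ∑ i, ∑ j, ((gram s u)⁻¹ i j * lor v (partialD j s u)) • partialD i s u

/-- The normal connection: the normal part of the derivative of the normal field `ξ` in the
`i`-th coordinate direction. -/
def normalD (s : E2 → Mink) (i : Fin 2) (ξ : E2 → Mink) (u : E2) : Mink :=
  normalProj s u (partialD i ξ u)

/-- `ξ` is, near `u`, a smooth normal field along `s`. -/
def IsNormalFieldNear (s : E2 → Mink) (u : E2) (ξ : E2 → Mink) : Prop :=
  ContDiffAt ℝ ∞ ξ u ∧ ∀ᶠ x in 𝓝 u, ∀ i, lor (ξ x) (partialD i s x) = 0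

variable {M : Type*} [TopologicalSpace M] [ChartedSpace E2 M]

/-- The map `S` read in the preferred chart at `p`. -/
def localRep (S : M → Mink) (p : M) : E2 → Mink :=
  fun u => S ((extChartAt (𝓡 2) p).symm u)

/-- The metric induced by `S` is flat: its curvature tensor vanishes at every point. -/
def IsFlat (S : M → Mink) : Prop :=
  ∀ (p : M) (l k i j : Fin 2),
    riemannTensor (gram (localRep S p)) l k i j (extChartAt (𝓡 2) p p) = 0

/-- The normal bundle of `S` is flat: the curvature `R(∂_i, ∂_j) ξ` of the normal connection
vanishes at every point, for all normal fields `ξ`. -/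
def HasFlatNormalBundle (S : M → Mink) : Prop :=
  ∀ (p : M) (ξ : E2 → Mink), IsNormalFieldNear (localRep S p) (extChartAt (𝓡 2) p p) ξ →
    ∀ i j : Fin 2,
      normalD (localRep S p) i (normalD (localRep S p) j ξ) (extChartAt (𝓡 2) p p) =
        normalD (localRep S p) j (normalD (localRep S p) i ξ) (extChartAt (𝓡 2) p p)

end Coordinates

end LaguerreGeom

end

noncomputable section

namespace LaguerreGeom

/-! ### The Lorentz product -/

/-! Everything is encoded in two operators on each tangent plane. An envelope with unit normal `n`
gives the null vector field `N = (-n, 1)`, the direction of its contact line; the contact condition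
says exactly that `N` is normal to `S`. Let `A` be the tangential part of `dN`, self-adjoint for the
induced metric `g`. As `N` is null with constant time component, III is `g (A ·) (A ·)`, and II is
`g (A ·) ·` minus `r` times III, `r` being the radius. So, for regular envelopes, `A` is invertible,
curvature directions are its eigenvectors, and the projected Gauss differential is `-A`.

With two envelopes and operators `A`, `A'`, the Gauss equation (`HasNullNormals.flat_iff`) turns
flatness of the metric into vanishing of the mixed discriminant of `A` and `A'`, and the Ricci
equation (`HasNullNormals.normal_flat_iff`) turns flatness of the normal bundle into `A A' = A' A`.

The rest of the pointwise theory is plane algebra. The Darboux condition asks for a common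
eigenbasis with eigenvalues `k' i = ± √c * k i`. Equal signs make `A'` a multiple of `A`; opposite
signs make the mixed discriminant vanish. Conversely, commuting invertible operators with zero mixed
discriminant satisfy the Darboux condition with opposite signs, so `det A * det A' < 0`: the
orientations differ everywhere and the congruence cannot be degenerate.

It remains to exclude the proportional case for nondegenerate congruences. If the metric is not flat
at a point, then `A' = l A` with `l ≠ 0` on a neighbourhood. Rescale `N'` to `Q` with the same shape
operator as `N`. Then `D = Q - N` has a normal differential, and symmetry of second derivatives
forces `dD` to be a multiple of `D`. Hence the reflection in the complement of `D` is constant; it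
exchanges `N` and `Q`, and it fixes `dS`, so it fixes `S` up to a translation. This is a Laguerre
equivalence of the two envelopes, with equal orientations, against nondegeneracy. -/

theorem lor_comm (u v : Mink) : lor u v = lor v u := by
  simp [lor, real_inner_comm, mul_comm]

theorem lor_add_left (u v w : Mink) : lor (u + v) w = lor u w + lor v w := by
  simp [lor, inner_add_left]; ring

theorem lor_add_right (u v w : Mink) : lor u (v + w) = lor u v + lor u w := by
  simp [lor, inner_add_right]; ring

theorem lor_smul_left (c : ℝ) (u v : Mink) : lor (c • u) v = c * lor u v := by
  simp [lor, inner_smul_left]; ring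

theorem lor_smul_right (c : ℝ) (u v : Mink) : lor u (c • v) = c * lor u v := by
  simp [lor, inner_smul_right]; ring

theorem lor_neg_right (u v : Mink) : lor u (-v) = -lor u v := by
  simp [lor]; ring

theorem lor_sub_left (u v w : Mink) : lor (u - v) w = lor u w - lor v w := by
  simp [lor, inner_sub_left]; ring

theorem lor_sub_right (u v w : Mink) : lor u (v - w) = lor u v - lor u w := by
  simp [lor, inner_sub_right]; ring

@[simp] theorem lor_zero_left (u : Mink) : lor 0 u = 0 := by simp [lor]

@[simp] theorem lor_zero_right (u : Mink) : lor u 0 = 0 := by simp [lor]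

theorem lor_sum_left {ι : Type*} (t : Finset ι) (F : ι → Mink) (v : Mink) :
    lor (∑ i ∈ t, F i) v = ∑ i ∈ t, lor (F i) v := by
  classical
  induction t using Finset.induction_on with
  | empty => simp
  | insert a t ha ih => rw [Finset.sum_insert ha, Finset.sum_insert ha, lor_add_left, ih]

/-- The Lorentz product as a continuous bilinear map. -/
def lorL : Mink →L[ℝ] Mink →L[ℝ] ℝ :=
  (LinearMap.mk₂ ℝ lor lor_add_left lor_smul_left lor_add_right lor_smul_right
    ).toContinuousBilinearMap

theorem lorL_apply (u v : Mink) : lorL u v = lor u v := rfl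

theorem lor_nondegenerate {u : Mink} (h : ∀ v, lor u v = 0) : u = 0 := by
  -- Reversing time turns the Lorentz product with `u` into the Euclidean square of `u`.
  have := h (u.1, -u.2)
  simp only [lor, real_inner_self_eq_norm_sq] at this
  have h1 : ‖u.1‖ = 0 := by nlinarith [sq_nonneg ‖u.1‖, sq_nonneg u.2]
  have h2 : u.2 = 0 := by nlinarith [sq_nonneg ‖u.1‖, sq_nonneg u.2]
  exact Prod.ext (norm_eq_zero.mp h1) h2

/-! ### Frames consisting of two tangent and two null normal vectors -/

/-- The null vectors `N`, `N'` are independent and orthogonal to `a` and `b`, which span a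
nondegenerate plane. -/
structure IsNullFrame (a b N N' : Mink) : Prop where
  gram_ne : lor a a * lor b b - lor a b ^ 2 ≠ 0
  null : lor N N = 0
  null' : lor N' N' = 0
  cross : lor N N' ≠ 0
  orth_a : lor a N = 0
  orth_a' : lor a N' = 0
  orth_b : lor b N = 0
  orth_b' : lor b N' = 0

namespace IsNullFrame


/-- Pairing a relation with `N` and `N'` isolates the null coefficients, since the null vectors pair
only with each other; the tangential ones then follow by Cramer's rule for the Gram matrix. -/
theorem linearIndependent {a b N N' : Mink} (h : IsNullFrame a b N N') :
    LinearIndependent ℝ ![a, b, N, N'] := by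
  rw [Fintype.linearIndependent_iff]
  intro c hc
  simp only [Fin.sum_univ_four, Matrix.cons_val] at hc
  have key : ∀ v, c 0 * lor a v + c 1 * lor b v + c 2 * lor N v + c 3 * lor N' v = 0 := by
    intro v
    have := congrArg (fun x => lor x v) hc
    simpa only [lor_add_left, lor_smul_left, lor_zero_left] using this
  have ka := key a
  have kb := key b
  have kN := key N
  have kN' := key N'
  rw [lor_comm N a, lor_comm N' a, h.orth_a, h.orth_a', lor_comm b a] at ka
  rw [lor_comm N b, lor_comm N' b, h.orth_b, h.orth_b'] at kb
  rw [h.orth_a, h.orth_b, h.null, lor_comm N' N] at kN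
  rw [h.orth_a', h.orth_b', h.null'] at kN'
  have h3 : c 3 = 0 := by
    have : c 3 * lor N N' = 0 := by linarith
    exact (mul_eq_zero.mp this).resolve_right h.cross
  have h2 : c 2 = 0 := by
    have : c 2 * lor N N' = 0 := by linarith
    exact (mul_eq_zero.mp this).resolve_right h.cross
  have h0 : c 0 = 0 := by
    have : c 0 * (lor a a * lor b b - lor a b ^ 2) = 0 := by
      linear_combination lor b b * ka - lor a b * kb
    exact (mul_eq_zero.mp this).resolve_right h.gram_ne
  have h1 : c 1 = 0 := by
    have : c 1 * (lor a a * lor b b - lor a b ^ 2) = 0 := by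
      linear_combination lor a a * kb - lor a b * ka
    exact (mul_eq_zero.mp this).resolve_right h.gram_ne
  intro i
  fin_cases i <;> assumption

theorem eq_zero {a b N N' : Mink} (h : IsNullFrame a b N N') {X : Mink} (ha : lor X a = 0)
    (hb : lor X b = 0) (hN : lor X N = 0) (hN' : lor X N' = 0) : X = 0 := by
  have hs : Submodule.span ℝ (Set.range ![a, b, N, N']) = ⊤ :=
    h.linearIndependent.span_eq_top_of_card_eq_finrank (by simp [Mink])
  refine lor_nondegenerate fun v => ?_
  have hv : v ∈ Submodule.span ℝ (Set.range ![a, b, N, N']) := hs ▸ Submodule.mem_top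
  induction hv using Submodule.span_induction with
  | mem x hx =>
    obtain ⟨i, rfl⟩ := hx
    fin_cases i <;> assumption
  | zero => simp
  | add x y _ _ hx hy => rw [lor_add_right, hx, hy, add_zero]
  | smul c x _ hx => rw [lor_smul_right, hx, mul_zero]

/-- The standard way of proving vector identities below: the frame has four members, so it spans,
and the product is nondegenerate. -/
theorem eq_of_lor_eq {a b N N' : Mink} (h : IsNullFrame a b N N') {X Y : Mink}
    (ha : lor X a = lor Y a) (hb : lor X b = lor Y b) (hN : lor X N = lor Y N)
    (hN' : lor X N' = lor Y N') : X = Y := by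
  refine sub_eq_zero.mp (h.eq_zero ?_ ?_ ?_ ?_) <;> rw [lor_sub_left] <;> linarith

end IsNullFrame

/-! ### Pairs of commuting self-adjoint operators of the plane -/

section Plane

variable {T : Type*} [AddCommGroup T] [Module ℝ T]

/-- A scalar product on a real vector space, given as a bilinear form. -/
structure IsScalarProduct (g : T →ₗ[ℝ] T →ₗ[ℝ] ℝ) : Prop where
  symm : ∀ v w, g v w = g w v
  pos : ∀ v, v ≠ 0 → 0 < g v v

theorem IsScalarProduct.eq_of_forall {g : T →ₗ[ℝ] T →ₗ[ℝ] ℝ} (hg : IsScalarProduct g) {v w : T}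
    (h : ∀ x, g v x = g w x) : v = w := by
  by_contra hne
  have h1 := hg.pos (v - w) (sub_ne_zero.mpr hne)
  have h2 : g (v - w) (v - w) = 0 := by
    rw [map_sub g, LinearMap.sub_apply, h, sub_self]
  linarith

theorem IsScalarProduct.exists_operator [FiniteDimensional ℝ T] {g : T →ₗ[ℝ] T →ₗ[ℝ] ℝ}
    (hg : IsScalarProduct g) (β : T →ₗ[ℝ] T →ₗ[ℝ] ℝ) :
    ∃ A : T →ₗ[ℝ] T, ∀ v w, g (A v) w = β v w := by
  have hinj : Function.Injective g := fun v w h => hg.eq_of_forall fun x => by rw [h]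
  let E : T ≃ₗ[ℝ] (T →ₗ[ℝ] ℝ) :=
    LinearMap.linearEquivOfInjective g hinj (Subspace.dual_finrank_eq (K := ℝ) (V := T)).symm
  refine ⟨E.symm.toLinearMap ∘ₗ β, fun v w => ?_⟩
  have h : g (E.symm (β v)) = β v := E.apply_symm_apply (β v)
  simp [h]

/-- The polarized determinant of the quadratic forms `g (A ·) ·` and `g (A' ·) ·`, evaluated on
two vectors. -/
def mixedDisc (g : T →ₗ[ℝ] T →ₗ[ℝ] ℝ) (A A' : T →ₗ[ℝ] T) (v w : T) : ℝ :=
  g (A v) v * g (A' w) w + g (A w) w * g (A' v) v - 2 * (g (A v) w * g (A' v) w)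

/-- A change of basis multiplies the mixed discriminant by the square of its determinant, so it
vanishes identically as soon as it vanishes on one basis. -/
theorem mixedDisc_comb {g : T →ₗ[ℝ] T →ₗ[ℝ] ℝ} {A A' : T →ₗ[ℝ] T}
    (hA : ∀ v w, g (A v) w = g (A w) v) (hA' : ∀ v w, g (A' v) w = g (A' w) v)
    (v w : T) (a b c d : ℝ) :
    mixedDisc g A A' (a • v + b • w) (c • v + d • w) = (a * d - b * c) ^ 2 * mixedDisc g A A' v w := by
  simp only [mixedDisc, map_add, map_smul, LinearMap.add_apply, LinearMap.smul_apply, smul_eq_mul]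
  rw [hA w v, hA' w v]
  ring

/-- Two independent vectors span a plane. -/
theorem exists_comb [FiniteDimensional ℝ T] (hT : Module.finrank ℝ T = 2) {v : Fin 2 → T}
    (hv : LinearIndependent ℝ v) (w : T) : ∃ a b : ℝ, w = a • v 0 + b • v 1 := by
  have hs : Submodule.span ℝ (Set.range v) = ⊤ :=
    hv.span_eq_top_of_card_eq_finrank (by simp [hT])
  have hw : w ∈ Submodule.span ℝ (Set.range v) := hs ▸ Submodule.mem_top
  rw [Submodule.mem_span_range_iff_exists_fun] at hw
  obtain ⟨c, hc⟩ := hw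
  exact ⟨c 0, c 1, by rw [← hc, Fin.sum_univ_two]⟩

/-- On a common eigenbasis conformality reads `k' i ^ 2 = c * k i ^ 2`, hence `k' i = ± √c * k i`.
Equal signs give proportionality, opposite signs a vanishing mixed discriminant. -/
theorem commute_and_proportional_or_mixedDisc_eq_zero [FiniteDimensional ℝ T]
    (hT : Module.finrank ℝ T = 2) {g : T →ₗ[ℝ] T →ₗ[ℝ] ℝ} (hg : IsScalarProduct g)
    {A A' : T →ₗ[ℝ] T}
    (hA : ∀ v w, g (A v) w = g (A w) v) (hA' : ∀ v w, g (A' v) w = g (A' w) v)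
    (hinj : Function.Injective A) {c : ℝ} (hc : 0 < c)
    (hconf : ∀ v w, g (A' v) (A' w) = c * g (A v) (A w)) {v : Fin 2 → T}
    (hv : LinearIndependent ℝ v) {k k' : Fin 2 → ℝ} (hk : ∀ i, A (v i) = k i • v i)
    (hk' : ∀ i, A' (v i) = k' i • v i) :
    (∀ x, A (A' x) = A' (A x)) ∧
      ((∃ l : ℝ, l ≠ 0 ∧ ∀ x, A' x = l • A x) ∨ ∀ x y, mixedDisc g A A' x y = 0) := by
  have hne : ∀ i, v i ≠ 0 := fun i => hv.ne_zero i
  have hk0 : ∀ i, k i ≠ 0 := by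
    intro i h0
    have h1 := hk i
    rw [h0, zero_smul] at h1
    exact hne i (hinj (by rw [h1, map_zero]))
  have hsq : ∀ i, k' i ^ 2 = c * k i ^ 2 := by
    intro i
    have h1 := hconf (v i) (v i)
    rw [hk, hk'] at h1
    simp only [map_smul, LinearMap.smul_apply, smul_eq_mul] at h1
    have h2 := hg.pos (v i) (hne i)
    have h3 : (k' i ^ 2 - c * k i ^ 2) * g (v i) (v i) = 0 := by linear_combination h1
    linarith [(mul_eq_zero.mp h3).resolve_right h2.ne']
  have hfac : ∀ i, k' i = √c * k i ∨ k' i = -√c * k i := by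
    intro i
    have h1 : (k' i - √c * k i) * (k' i + √c * k i) = 0 := by
      linear_combination hsq i - k i ^ 2 * Real.sq_sqrt hc.le
    rcases mul_eq_zero.mp h1 with h | h
    · left; linarith
    · right; linarith
  have hc0 : √c ≠ 0 := (Real.sqrt_pos.mpr hc).ne'
  refine ⟨fun x => ?_, ?_⟩
  · obtain ⟨a, b, rfl⟩ := exists_comb hT hv x
    simp only [map_add, map_smul, hk, hk', smul_smul]
    congr 2 <;> ring
  have hprop : ∀ l : ℝ, l ≠ 0 → k' 0 = l * k 0 → k' 1 = l * k 1 →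
      ∃ l : ℝ, l ≠ 0 ∧ ∀ x, A' x = l • A x := by
    intro l hl h0 h1
    refine ⟨l, hl, fun x => ?_⟩
    obtain ⟨a, b, rfl⟩ := exists_comb hT hv x
    simp only [map_add, map_smul, hk, hk', smul_smul, smul_add, h0, h1]
    congr 2 <;> ring
  have hmix : ∀ l : ℝ, l ≠ 0 → k' 0 = l * k 0 → k' 1 = -l * k 1 →
      ∀ x y, mixedDisc g A A' x y = 0 := by
    intro l hl h0 h1 x y
    obtain ⟨a, b, rfl⟩ := exists_comb hT hv x
    obtain ⟨a', b', rfl⟩ := exists_comb hT hv y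
    rw [mixedDisc_comb hA hA']
    have s1 := hA (v 0) (v 1)
    have s2 := hA' (v 0) (v 1)
    rw [hk, hk] at s1
    rw [hk', hk', h0, h1] at s2
    simp only [map_smul, LinearMap.smul_apply, smul_eq_mul] at s1 s2
    rw [hg.symm (v 1) (v 0)] at s1 s2
    -- The eigenbasis is not assumed orthogonal. Self-adjointness gives `k 0 = k 1` and `k 0 = -k 1`
    -- after multiplication by `g (v 0) (v 1)`, which kills the only term that does not cancel by
    -- itself.
    have s3 : k 0 * g (v 0) (v 1) = 0 := by
      have : (2 * l) * (k 0 * g (v 0) (v 1)) = 0 := by linear_combination s2 + l * s1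
      exact (mul_eq_zero.mp this).resolve_left (by simpa using hl)
    simp only [mixedDisc, hk, hk', map_smul, LinearMap.smul_apply, smul_eq_mul, h0, h1]
    linear_combination ((a * b' - b * a') ^ 2) * (-2 * l * (k 0 * g (v 0) (v 1))) * s3
  rcases hfac 0 with h0 | h0 <;> rcases hfac 1 with h1 | h1
  · exact Or.inl (hprop _ hc0 h0 h1)
  · exact Or.inr (hmix _ hc0 h0 h1)
  · exact Or.inr (hmix _ (neg_ne_zero.mpr hc0) h0 (by rw [neg_neg]; exact h1))
  · exact Or.inl (hprop _ (neg_ne_zero.mpr hc0) h0 h1)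

theorem exists_orthonormal_pair [FiniteDimensional ℝ T] (hT : Module.finrank ℝ T = 2)
    {g : T →ₗ[ℝ] T →ₗ[ℝ] ℝ} (hg : IsScalarProduct g) :
    ∃ e f : T, g e e = 1 ∧ g f f = 1 ∧ g e f = 0 := by
  have b := Module.finBasisOfFinrankEq ℝ T hT
  have hb := b.linearIndependent
  have norm : ∀ x : T, x ≠ 0 → g ((√(g x x))⁻¹ • x) ((√(g x x))⁻¹ • x) = 1 := by
    intro x hx
    have h1 := hg.pos x hx
    have h2 := Real.sq_sqrt h1.le
    have h3 : √(g x x) ≠ 0 := (Real.sqrt_pos.mpr h1).ne'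
    simp only [map_smul, LinearMap.smul_apply, smul_eq_mul]
    field_simp
    exact h2.symm
  have h0 : b 0 ≠ 0 := b.ne_zero 0
  set w : T := b 1 - (g (b 0) (b 1) / g (b 0) (b 0)) • b 0 with hw
  have hw0 : w ≠ 0 := by
    intro h
    have := Fintype.linearIndependent_iff.mp hb ![-(g (b 0) (b 1) / g (b 0) (b 0)), 1]
      (by rw [Fin.sum_univ_two, ← h, hw]; simp; abel) 1
    simp at this
  have h01 : g (b 0) w = 0 := by
    have := (hg.pos _ h0).ne'
    simp only [hw, map_sub, map_smul, smul_eq_mul]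
    field_simp
    ring
  refine ⟨_, _, norm _ h0, norm _ hw0, ?_⟩
  simp [h01]

/-- Rotating an orthonormal basis to `x e + y f`, `-y e + x f` changes the off-diagonal entry of a
self-adjoint `L` into `(x² - y²) L_ef - x y (L_ee - L_ff)`. One rotation has to annihilate this for
both operators. -/
theorem exists_common_eigenbasis [FiniteDimensional ℝ T] (hT : Module.finrank ℝ T = 2)
    {g : T →ₗ[ℝ] T →ₗ[ℝ] ℝ} (hg : IsScalarProduct g) {A A' : T →ₗ[ℝ] T}
    (hA : ∀ v w, g (A v) w = g (A w) v) (hA' : ∀ v w, g (A' v) w = g (A' w) v)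
    (hcomm : ∀ x, A (A' x) = A' (A x)) :
    ∃ v : Fin 2 → T, LinearIndependent ℝ v ∧ g (v 0) (v 1) = 0 ∧
      (∀ i, A (v i) = (g (A (v i)) (v i) / g (v i) (v i)) • v i) ∧
      (∀ i, A' (v i) = (g (A' (v i)) (v i) / g (v i) (v i)) • v i) := by
  obtain ⟨e, f, he, hf, hef⟩ := exists_orthonormal_pair hT hg
  have hfe : g f e = 0 := by rw [hg.symm, hef]
  have hrot : ∀ x y : ℝ, x ^ 2 + y ^ 2 ≠ 0 →
      LinearIndependent ℝ ![x • e + y • f, (-y) • e + x • f] := by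
    intro x y hxy
    rw [Fintype.linearIndependent_iff]
    intro c hc
    rw [Fin.sum_univ_two] at hc
    simp only [Matrix.cons_val] at hc
    have k1 := congrArg (g e) hc
    have k2 := congrArg (g f) hc
    simp only [map_add, map_smul, smul_eq_mul, he, hf, hef, hfe, map_zero] at k1 k2
    have c0 : c 0 * (x ^ 2 + y ^ 2) = 0 := by linear_combination x * k1 + y * k2
    have c1 : c 1 * (x ^ 2 + y ^ 2) = 0 := by linear_combination x * k2 - y * k1
    intro i
    fin_cases i
    · exact (mul_eq_zero.mp c0).resolve_right hxy
    · exact (mul_eq_zero.mp c1).resolve_right hxy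
  have hon : LinearIndependent ℝ ![e, f] := by simpa using hrot 1 0 (by norm_num)
  have hdec : ∀ x, x = g x e • e + g x f • f := by
    intro x
    obtain ⟨a, b, h⟩ := exists_comb hT hon x
    simp only [Matrix.cons_val] at h
    rw [h]
    simp [he, hf, hef, hfe]
  -- Commutation says that the pairs `(L_ee - L_ff, L_ef)` of the two operators are parallel, so a
  -- rotation adapted to a nonzero one suits both.
  have hpar : g (A e) f * (g (A' e) e - g (A' f) f) = g (A' e) f * (g (A e) e - g (A f) f) := by
    have h1 : g (A (A' e)) f = g (A' (A e)) f := by rw [hcomm]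
    rw [hA, hA', hdec (A f), hdec (A' f), hA f e, hA' f e] at h1
    simp only [map_add, map_smul, LinearMap.add_apply, LinearMap.smul_apply, smul_eq_mul] at h1
    rw [hg.symm e (A' e), hg.symm f (A' e), hg.symm e (A e), hg.symm f (A e)] at h1
    linear_combination h1
  have hz : ∃ x y : ℝ, x ^ 2 + y ^ 2 ≠ 0 ∧
      (x ^ 2 - y ^ 2) * g (A e) f = x * y * (g (A e) e - g (A f) f) ∧
      (x ^ 2 - y ^ 2) * g (A' e) f = x * y * (g (A' e) e - g (A' f) f) := by
    -- Doubling the angle is squaring in `ℂ`: `x + i y` is a square root of `p + 2 i q`.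
    have hroot : ∀ p q : ℝ, ∃ x y : ℝ, x ^ 2 - y ^ 2 = p ∧ x * y = q := by
      intro p q
      obtain ⟨z, hz⟩ := IsAlgClosed.exists_pow_nat_eq (⟨p, 2 * q⟩ : ℂ) (n := 2) (by norm_num)
      have hre := congrArg Complex.re hz
      have him := congrArg Complex.im hz
      simp only [sq, Complex.mul_re, Complex.mul_im] at hre him
      exact ⟨z.re, z.im, by linarith, by linarith⟩
    by_cases h1 : g (A e) e - g (A f) f = 0 ∧ g (A e) f = 0
    · by_cases h2 : g (A' e) e - g (A' f) f = 0 ∧ g (A' e) f = 0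
      · exact ⟨1, 0, by norm_num, by rw [h1.2]; ring, by rw [h2.2]; ring⟩
      · obtain ⟨x, y, hx, hy⟩ := hroot (g (A' e) e - g (A' f) f) (g (A' e) f)
        refine ⟨x, y, fun h => h2 ?_, ?_, ?_⟩
        · have hx0 : x = 0 := by nlinarith [sq_nonneg x, sq_nonneg y]
          have hy0 : y = 0 := by nlinarith [sq_nonneg x, sq_nonneg y]
          rw [← hx, ← hy, hx0, hy0]; simp
        · rw [h1.1, h1.2]; ring
        · rw [hx, hy]; ring
    · obtain ⟨x, y, hx, hy⟩ := hroot (g (A e) e - g (A f) f) (g (A e) f)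
      refine ⟨x, y, fun h => h1 ?_, ?_, ?_⟩
      · have hx0 : x = 0 := by nlinarith [sq_nonneg x, sq_nonneg y]
        have hy0 : y = 0 := by nlinarith [sq_nonneg x, sq_nonneg y]
        rw [← hx, ← hy, hx0, hy0]; simp
      · rw [hx, hy]; ring
      · rw [hx, hy]; linarith
  obtain ⟨x, y, hxy, h1, h2⟩ := hz
  have hli := hrot x y hxy
  set v : Fin 2 → T := ![x • e + y • f, (-y) • e + x • f] with hv
  have horth : g (v 0) (v 1) = 0 := by
    simp [hv, he, hf, hef, hfe]; ring
  have heig : ∀ L : T →ₗ[ℝ] T, (∀ v w, g (L v) w = g (L w) v) → g (L (v 0)) (v 1) = 0 →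
      ∀ i, L (v i) = (g (L (v i)) (v i) / g (v i) (v i)) • v i := by
    intro L hL h0 i
    refine hg.eq_of_forall fun w => ?_
    obtain ⟨a, b, rfl⟩ := exists_comb hT hli w
    have hi := (hg.pos _ (hli.ne_zero i)).ne'
    have h0' : g (L (v 1)) (v 0) = 0 := by rw [← hL, h0]
    have horth' : g (v 1) (v 0) = 0 := by rw [hg.symm, horth]
    fin_cases i
    · simp only [Fin.zero_eta, map_add, map_smul, smul_eq_mul, LinearMap.smul_apply, h0, horth]
        at hi ⊢
      field_simp
      ring
    · simp only [Fin.mk_one, map_add, map_smul, smul_eq_mul, LinearMap.smul_apply, h0', horth']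
        at hi ⊢
      field_simp
      ring
  refine ⟨v, hli, horth, heig A hA ?_, heig A' hA' ?_⟩
  · simp only [hv, Matrix.cons_val, map_add, map_smul, LinearMap.add_apply, LinearMap.smul_apply,
      smul_eq_mul]
    rw [hA f e]
    linear_combination h1
  · simp only [hv, Matrix.cons_val, map_add, map_smul, LinearMap.add_apply, LinearMap.smul_apply,
      smul_eq_mul]
    rw [hA' f e]
    linear_combination h2

theorem det_of_eigenbasis [FiniteDimensional ℝ T] (hT : Module.finrank ℝ T = 2)
    {A : T →ₗ[ℝ] T} {v : Fin 2 → T} (hv : LinearIndependent ℝ v) {k : Fin 2 → ℝ}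
    (hk : ∀ i, A (v i) = k i • v i) : LinearMap.det A = k 0 * k 1 := by
  let b := basisOfLinearIndependentOfCardEqFinrank hv (by simp [hT])
  have hb : ∀ i, b i = v i := fun i => by simp [b]
  have hAb : ∀ i, A (b i) = k i • b i := fun i => by rw [hb, hk]
  rw [← LinearMap.det_toMatrix b, Matrix.det_fin_two]
  simp [LinearMap.toMatrix_apply, hAb]

/-- On an orthogonal common eigenbasis the mixed discriminant is a nonzero multiple of `k 0 * k' 1 +
k 1 * k' 0`. Its vanishing means that the ratios `k' i / k i` are opposite: equal squares give
conformality, opposite signs give the sign of the determinants. -/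
theorem eigenbasis_of_commute_of_mixedDisc_eq_zero [FiniteDimensional ℝ T]
    (hT : Module.finrank ℝ T = 2)
    {g : T →ₗ[ℝ] T →ₗ[ℝ] ℝ} (hg : IsScalarProduct g) {A A' : T →ₗ[ℝ] T}
    (hA : ∀ v w, g (A v) w = g (A w) v) (hA' : ∀ v w, g (A' v) w = g (A' w) v)
    (hinj : Function.Injective A) (hinj' : Function.Injective A')
    (hcomm : ∀ x, A (A' x) = A' (A x)) (hmix : ∀ x y, mixedDisc g A A' x y = 0) :
    (∃ v : Fin 2 → T, LinearIndependent ℝ v ∧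
      (∀ i, ∃ k : ℝ, k ≠ 0 ∧ A (v i) = k • v i) ∧ ∀ i, ∃ k : ℝ, k ≠ 0 ∧ A' (v i) = k • v i) ∧
    (∃ c : ℝ, 0 < c ∧ ∀ v w, g (A' v) (A' w) = c * g (A v) (A w)) ∧
      LinearMap.det A * LinearMap.det A' < 0 := by
  obtain ⟨v, hv, h01, hk, hk'⟩ := exists_common_eigenbasis hT hg hA hA' hcomm
  generalize hkd : (fun i => g (A (v i)) (v i) / g (v i) (v i)) = k at hk
  generalize hkd' : (fun i => g (A' (v i)) (v i) / g (v i) (v i)) = k' at hk'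
  replace hk : ∀ i, A (v i) = k i • v i := fun i => by rw [← hkd]; exact hk i
  replace hk' : ∀ i, A' (v i) = k' i • v i := fun i => by rw [← hkd']; exact hk' i
  have hne : ∀ (L : T →ₗ[ℝ] T) (l : Fin 2 → ℝ), Function.Injective L →
      (∀ i, L (v i) = l i • v i) → ∀ i, l i ≠ 0 := by
    intro L l hL hl i h0
    have h1 := hl i
    rw [h0, zero_smul] at h1
    exact hv.ne_zero i (hL (by rw [h1, map_zero]))
  have k0 := hne A k hinj hk
  have k0' := hne A' k' hinj' hk'
  have hm := hmix (v 0) (v 1)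
  have g0 := (hg.pos _ (hv.ne_zero 0)).ne'
  have g1 := (hg.pos _ (hv.ne_zero 1)).ne'
  simp only [mixedDisc, hk, hk', map_smul, LinearMap.smul_apply, smul_eq_mul, h01] at hm
  have hm' : k 0 * k' 1 + k 1 * k' 0 = 0 := by
    have : (k 0 * k' 1 + k 1 * k' 0) * (g (v 0) (v 0) * g (v 1) (v 1)) = 0 := by
      linear_combination hm
    exact (mul_eq_zero.mp this).resolve_right (mul_ne_zero g0 g1)
  refine ⟨⟨v, hv, fun i => ⟨k i, k0 i, hk i⟩, fun i => ⟨k' i, k0' i, hk' i⟩⟩, ?_, ?_⟩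
  · refine ⟨(k' 0 / k 0) ^ 2, by have := k0 0; have := k0' 0; positivity, fun x y => ?_⟩
    obtain ⟨a, b, rfl⟩ := exists_comb hT hv x
    obtain ⟨a', b', rfl⟩ := exists_comb hT hv y
    have e0 : k' 0 ^ 2 = (k' 0 / k 0) ^ 2 * k 0 ^ 2 := by have := k0 0; field_simp
    have e1 : k' 1 ^ 2 = (k' 0 / k 0) ^ 2 * k 1 ^ 2 := by
      have := k0 0
      field_simp
      linear_combination (k 0 * k' 1 - k 1 * k' 0) * hm'
    have h10 : g (v 1) (v 0) = 0 := by rw [hg.symm, h01]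
    simp only [map_add, map_smul, hk, hk', LinearMap.add_apply, LinearMap.smul_apply, smul_eq_mul,
      h01, h10]
    linear_combination a * a' * g (v 0) (v 0) * e0 + b * b' * g (v 1) (v 1) * e1
  · rw [det_of_eigenbasis hT hv hk, det_of_eigenbasis hT hv hk']
    have h2 : k 0 * k 1 * (k' 0 * k' 1) = -(k 1 * k' 0) ^ 2 := by
      linear_combination k 1 * k' 0 * hm'
    have h3 : 0 < (k 1 * k' 0) ^ 2 := by have := k0 1; have := k0' 0; positivity
    linarith

end Plane

/-! ### Calculus in a coordinate plane -/

section Calculus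

variable {W : Type*} [NormedAddCommGroup W] [NormedSpace ℝ W]

theorem contDiffOn_fderiv_apply {U : Set E2} (hU : IsOpen U) {F : E2 → W}
    (hF : ContDiffOn ℝ ∞ F U) (v : E2) : ContDiffOn ℝ ∞ (fun y => fderiv ℝ F y v) U :=
  (hF.fderiv_of_isOpen hU (by norm_cast)).clm_apply contDiffOn_const

theorem contDiffOn_partialD {U : Set E2} (hU : IsOpen U) {F : E2 → W}
    (hF : ContDiffOn ℝ ∞ F U) (i : Fin 2) : ContDiffOn ℝ ∞ (partialD i F) U :=
  contDiffOn_fderiv_apply hU hF _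

theorem differentiableAt_of_contDiffOn {U : Set E2} (hU : IsOpen U) {F : E2 → W}
    (hF : ContDiffOn ℝ ∞ F U) {x : E2} (hx : x ∈ U) : DifferentiableAt ℝ F x :=
  (hF.contDiffAt (hU.mem_nhds hx)).differentiableAt (by simp)

theorem fderiv_fderiv_comm {U : Set E2} (hU : IsOpen U) {F : E2 → W}
    (hF : ContDiffOn ℝ ∞ F U) {x : E2} (hx : x ∈ U) (v w : E2) :
    fderiv ℝ (fun y => fderiv ℝ F y v) x w = fderiv ℝ (fun y => fderiv ℝ F y w) x v := by
  have hF' := differentiableAt_of_contDiffOn hU (hF.fderiv_of_isOpen hU (by norm_cast)) hx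
  have hs := (hF.contDiffAt (hU.mem_nhds hx)).isSymmSndFDerivAt
    (by simp only [minSmoothness_of_isRCLikeNormedField]; norm_cast)
  rw [fderiv_clm_apply hF' (differentiableAt_const v),
    fderiv_clm_apply hF' (differentiableAt_const w)]
  simpa using hs.eq w v

theorem partialD_comm {U : Set E2} (hU : IsOpen U) {F : E2 → W}
    (hF : ContDiffOn ℝ ∞ F U) {x : E2} (hx : x ∈ U) (i j : Fin 2) :
    partialD i (partialD j F) x = partialD j (partialD i F) x :=
  fderiv_fderiv_comm hU hF hx _ _

theorem partialD_congr {U : Set E2} (hU : IsOpen U) {F G : E2 → W} (h : ∀ y ∈ U, F y = G y)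
    {x : E2} (hx : x ∈ U) (i : Fin 2) : partialD i F x = partialD i G x := by
  have : F =ᶠ[𝓝 x] G := Filter.eventuallyEq_of_mem (hU.mem_nhds hx) h
  simp only [partialD, this.fderiv_eq]

theorem contDiffOn_lor {U : Set E2} {F G : E2 → Mink} (hF : ContDiffOn ℝ ∞ F U)
    (hG : ContDiffOn ℝ ∞ G U) : ContDiffOn ℝ ∞ (fun y => lor (F y) (G y)) U := by
  simp only [← lorL_apply]
  exact (contDiffOn_const.clm_apply hF).clm_apply hG

theorem fderiv_lor {F G : E2 → Mink} {x : E2} (hF : DifferentiableAt ℝ F x)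
    (hG : DifferentiableAt ℝ G x) (v : E2) :
    fderiv ℝ (fun y => lor (F y) (G y)) x v =
      lor (fderiv ℝ F x v) (G x) + lor (F x) (fderiv ℝ G x v) := by
  have h := lorL.hasFDerivAt_of_bilinear hF.hasFDerivAt hG.hasFDerivAt
  simp only [← lorL_apply]
  rw [h.fderiv]
  simp [add_comm]

theorem partialD_lor {F G : E2 → Mink} {x : E2} (hF : DifferentiableAt ℝ F x)
    (hG : DifferentiableAt ℝ G x) (i : Fin 2) :
    partialD i (fun y => lor (F y) (G y)) x =
      lor (partialD i F x) (G x) + lor (F x) (partialD i G x) :=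
  fderiv_lor hF hG _

theorem partialD_add {F G : E2 → W} {x : E2} (hF : DifferentiableAt ℝ F x)
    (hG : DifferentiableAt ℝ G x) (i : Fin 2) :
    partialD i (fun y => F y + G y) x = partialD i F x + partialD i G x := by
  simp [partialD, fderiv_fun_add hF hG]

theorem partialD_mul {a b : E2 → ℝ} {x : E2} (ha : DifferentiableAt ℝ a x)
    (hb : DifferentiableAt ℝ b x) (i : Fin 2) :
    partialD i (fun y => a y * b y) x = partialD i a x * b x + a x * partialD i b x := by
  simp [partialD, fderiv_fun_mul ha hb]; ring

theorem partialD_sum {F : Fin 2 → E2 → W} {x : E2} (hF : ∀ l, DifferentiableAt ℝ (F l) x)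
    (i : Fin 2) : partialD i (fun y => ∑ l, F l y) x = ∑ l, partialD i (F l) x := by
  simp only [Fin.sum_univ_two]
  exact partialD_add (hF 0) (hF 1) i

end Calculus

/-! ### Space-like surfaces with two null normal fields -/

/-- The scalar product induced by a linear map into Minkowski space. -/
def pullback (σ : E2 →L[ℝ] Mink) : E2 →ₗ[ℝ] E2 →ₗ[ℝ] ℝ :=
  LinearMap.mk₂ ℝ (fun v w => lor (σ v) (σ w))
    (fun u v w => by rw [map_add, lor_add_left]) (fun c u v => by rw [map_smul, lor_smul_left]; rfl)
    (fun u v w => by rw [map_add, lor_add_right])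
    (fun c u v => by rw [map_smul, lor_smul_right]; rfl)

@[simp] theorem pullback_apply (σ : E2 →L[ℝ] Mink) (v w : E2) :
    pullback σ v w = lor (σ v) (σ w) := rfl

theorem single_comb_ne {a b : ℝ} (hab : a ≠ 0 ∨ b ≠ 0) :
    a • EuclideanSpace.single (0 : Fin 2) (1 : ℝ) + b • EuclideanSpace.single 1 1 ≠ 0 := by
  intro h0
  have e0 := congrArg (fun v : E2 => v 0) h0
  have e1 := congrArg (fun v : E2 => v 1) h0
  simp at e0 e1
  tauto

theorem gram_det_pos_of_spacelike {s : E2 → Mink} {x : E2}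
    (h : ∀ v ≠ 0, 0 < lor (fderiv ℝ s x v) (fderiv ℝ s x v)) :
    0 < lor (partialD 0 s x) (partialD 0 s x) * lor (partialD 1 s x) (partialD 1 s x) -
      lor (partialD 0 s x) (partialD 1 s x) ^ 2 := by
  have hp : ∀ a b : ℝ, a ≠ 0 ∨ b ≠ 0 → 0 < a ^ 2 * lor (partialD 0 s x) (partialD 0 s x) +
      2 * a * b * lor (partialD 0 s x) (partialD 1 s x) +
      b ^ 2 * lor (partialD 1 s x) (partialD 1 s x) := by
    intro a b hab
    have := h _ (single_comb_ne hab)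
    simp only [map_add, map_smul, lor_add_left, lor_add_right, lor_smul_left, lor_smul_right]
      at this
    simp only [partialD]
    rw [lor_comm (fderiv ℝ s x (EuclideanSpace.single 1 1))
      (fderiv ℝ s x (EuclideanSpace.single 0 1))] at this
    linarith
  have h0 := hp 1 0 (by norm_num)
  -- This tangent vector is orthogonal to the first coordinate vector; its square is the first
  -- diagonal entry times the Gram determinant.
  have h1 := hp (-lor (partialD 0 s x) (partialD 1 s x)) (lor (partialD 0 s x) (partialD 0 s x))
    (Or.inr (by linarith))
  have h2 : 0 < lor (partialD 0 s x) (partialD 0 s x) *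
      (lor (partialD 0 s x) (partialD 0 s x) * lor (partialD 1 s x) (partialD 1 s x) -
      lor (partialD 0 s x) (partialD 1 s x) ^ 2) := by linarith
  exact pos_of_mul_pos_right h2 (by linarith)

/-- On the open set `U`, the map `s` is a space-like immersion, and `N`, `N'` are
two independent null normal fields of it. -/
structure HasNullNormals (U : Set E2) (s N N' : E2 → Mink) : Prop where
  isOpen : IsOpen U
  smooth_s : ContDiffOn ℝ ∞ s U
  smooth_N : ContDiffOn ℝ ∞ N U
  smooth_N' : ContDiffOn ℝ ∞ N' U
  spacelike : ∀ x ∈ U, ∀ v ≠ 0, 0 < lor (fderiv ℝ s x v) (fderiv ℝ s x v)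
  null : ∀ x ∈ U, lor (N x) (N x) = 0
  null' : ∀ x ∈ U, lor (N' x) (N' x) = 0
  cross : ∀ x ∈ U, lor (N x) (N' x) ≠ 0
  orth : ∀ x ∈ U, ∀ v, lor (fderiv ℝ s x v) (N x) = 0
  orth' : ∀ x ∈ U, ∀ v, lor (fderiv ℝ s x v) (N' x) = 0

namespace HasNullNormals

variable {U : Set E2} {s N N' : E2 → Mink}

theorem swap (h : HasNullNormals U s N N') : HasNullNormals U s N' N where
  isOpen := h.isOpen
  smooth_s := h.smooth_s
  smooth_N := h.smooth_N'
  smooth_N' := h.smooth_N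
  spacelike := h.spacelike
  null := h.null'
  null' := h.null
  cross x hx := by rw [lor_comm]; exact h.cross x hx
  orth := h.orth'
  orth' := h.orth

theorem mono (h : HasNullNormals U s N N') {U' : Set E2} (hU : IsOpen U') (hs : U' ⊆ U) :
    HasNullNormals U' s N N' where
  isOpen := hU
  smooth_s := h.smooth_s.mono hs
  smooth_N := h.smooth_N.mono hs
  smooth_N' := h.smooth_N'.mono hs
  spacelike x hx := h.spacelike x (hs hx)
  null x hx := h.null x (hs hx)
  null' x hx := h.null' x (hs hx)
  cross x hx := h.cross x (hs hx)
  orth x hx := h.orth x (hs hx)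
  orth' x hx := h.orth' x (hs hx)

variable {x : E2}

theorem isScalarProduct (h : HasNullNormals U s N N') (hx : x ∈ U) :
    IsScalarProduct (pullback (fderiv ℝ s x)) where
  symm _ _ := lor_comm _ _
  pos v hv := h.spacelike x hx v hv

theorem gram_det_pos (h : HasNullNormals U s N N') (hx : x ∈ U) :
    0 < lor (partialD 0 s x) (partialD 0 s x) * lor (partialD 1 s x) (partialD 1 s x) -
      lor (partialD 0 s x) (partialD 1 s x) ^ 2 :=
  gram_det_pos_of_spacelike (h.spacelike x hx)

theorem frame (h : HasNullNormals U s N N') (hx : x ∈ U) :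
    IsNullFrame (partialD 0 s x) (partialD 1 s x) (N x) (N' x) where
  gram_ne := (h.gram_det_pos hx).ne'
  null := h.null x hx
  null' := h.null' x hx
  cross := h.cross x hx
  orth_a := h.orth x hx _
  orth_a' := h.orth' x hx _
  orth_b := h.orth x hx _
  orth_b' := h.orth' x hx _

theorem eq_of_lor_eq (h : HasNullNormals U s N N') (hx : x ∈ U) {X Y : Mink}
    (hT : ∀ v, lor X (fderiv ℝ s x v) = lor Y (fderiv ℝ s x v)) (hN : lor X (N x) = lor Y (N x))
    (hN' : lor X (N' x) = lor Y (N' x)) : X = Y :=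
  (h.frame hx).eq_of_lor_eq (hT _) (hT _) hN hN'

theorem diff_s (h : HasNullNormals U s N N') (hx : x ∈ U) : DifferentiableAt ℝ s x :=
  differentiableAt_of_contDiffOn h.isOpen h.smooth_s hx

theorem diff_N (h : HasNullNormals U s N N') (hx : x ∈ U) : DifferentiableAt ℝ N x :=
  differentiableAt_of_contDiffOn h.isOpen h.smooth_N hx

theorem diff_ds (h : HasNullNormals U s N N') (hx : x ∈ U) (v : E2) :
    DifferentiableAt ℝ (fun y => fderiv ℝ s y v) x :=
  differentiableAt_of_contDiffOn h.isOpen (contDiffOn_fderiv_apply h.isOpen h.smooth_s v) hx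

theorem lor_dN_N (h : HasNullNormals U s N N') (hx : x ∈ U) (v : E2) :
    lor (fderiv ℝ N x v) (N x) = 0 := by
  have h1 : (fun y => lor (N y) (N y)) =ᶠ[𝓝 x] fun _ => 0 :=
    Filter.eventuallyEq_of_mem (h.isOpen.mem_nhds hx) h.null
  have h2 := fderiv_lor (h.diff_N hx) (h.diff_N hx) v
  rw [h1.fderiv_eq, lor_comm (N x)] at h2
  simp at h2
  linarith

theorem lor_dds_N (h : HasNullNormals U s N N') (hx : x ∈ U) (v w : E2) :
    lor (fderiv ℝ (fun y => fderiv ℝ s y v) x w) (N x) =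
      -lor (fderiv ℝ s x v) (fderiv ℝ N x w) := by
  have h1 : (fun y => lor (fderiv ℝ s y v) (N y)) =ᶠ[𝓝 x] fun _ => 0 :=
    Filter.eventuallyEq_of_mem (h.isOpen.mem_nhds hx) fun y hy => h.orth y hy v
  have h2 := fderiv_lor (h.diff_ds hx v) (h.diff_N hx) w
  rw [h1.fderiv_eq] at h2
  simp at h2
  linarith

/-- By differentiating `⟨ds v, N⟩ = 0`, both sides become minus the pairing of `N` with a second
derivative of `s`, which is symmetric. -/
theorem lor_ds_dN_symm (h : HasNullNormals U s N N') (hx : x ∈ U) (v w : E2) :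
    lor (fderiv ℝ s x v) (fderiv ℝ N x w) = lor (fderiv ℝ s x w) (fderiv ℝ N x v) := by
  have h1 := h.lor_dds_N hx v w
  have h2 := h.lor_dds_N hx w v
  rw [fderiv_fderiv_comm h.isOpen h.smooth_s hx v w] at h1
  linarith

/-- `A` is the tangential part of the differential of the null normal field `N`. -/
theorem exists_shape (h : HasNullNormals U s N N') (hx : x ∈ U) :
    ∃ A : E2 →ₗ[ℝ] E2,
      (∀ v w, pullback (fderiv ℝ s x) (A v) w = pullback (fderiv ℝ s x) (A w) v) ∧
      (∀ v w, lor (fderiv ℝ s x v) (fderiv ℝ N x w) = pullback (fderiv ℝ s x) (A w) v) ∧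
      ∀ v, fderiv ℝ N x v = fderiv ℝ s x (A v) +
        (lor (fderiv ℝ N x v) (N' x) / lor (N x) (N' x)) • N x := by
  obtain ⟨A, hA⟩ := (h.isScalarProduct hx).exists_operator
    (LinearMap.mk₂ ℝ (fun v w => lor (fderiv ℝ N x v) (fderiv ℝ s x w))
    (fun u v w => by rw [map_add, lor_add_left]) (fun c u v => by rw [map_smul, lor_smul_left]; rfl)
    (fun u v w => by rw [map_add, lor_add_right])
    (fun c u v => by rw [map_smul, lor_smul_right]; rfl))
  simp only [LinearMap.mk₂_apply] at hA
  refine ⟨A, fun v w => ?_, fun v w => ?_, fun v => ?_⟩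
  · rw [hA, hA, lor_comm, h.lor_ds_dN_symm hx, lor_comm]
  · rw [hA, lor_comm]
  · refine h.eq_of_lor_eq hx (fun w => ?_) ?_ ?_
    · rw [lor_add_left, lor_smul_left, lor_comm (N x) (fderiv ℝ s x w), h.orth x hx, ← hA]
      simp
    · rw [lor_add_left, lor_smul_left, h.null x hx, h.orth x hx, h.lor_dN_N hx]
      simp
    · rw [lor_add_left, lor_smul_left, h.orth' x hx, div_mul_cancel₀ _ (h.cross x hx), zero_add]

end HasNullNormals

namespace HasNullNormals

variable {U : Set E2} {s N N' : E2 → Mink} {x : E2}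

/-! ### The Gauss equation -/

theorem gram_isUnit_det (h : HasNullNormals U s N N') (hx : x ∈ U) :
    IsUnit (gram s x).det := by
  have h1 := h.gram_det_pos hx
  rw [isUnit_iff_ne_zero, Matrix.det_fin_two]
  simp only [gram, Matrix.of_apply]
  rw [lor_comm (partialD 1 s x) (partialD 0 s x)]
  nlinarith

theorem contDiffOn_gram (h : HasNullNormals U s N N') (i j : Fin 2) :
    ContDiffOn ℝ ∞ (fun y => gram s y i j) U :=
  contDiffOn_lor (contDiffOn_partialD h.isOpen h.smooth_s i)
    (contDiffOn_partialD h.isOpen h.smooth_s j)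

theorem contDiffOn_gram_inv (h : HasNullNormals U s N N') (i j : Fin 2) :
    ContDiffOn ℝ ∞ (fun y => (gram s y)⁻¹ i j) U := by
  have hdet : ContDiffOn ℝ ∞ (fun y => (gram s y).det) U := by
    simp only [Matrix.det_fin_two]
    exact ((h.contDiffOn_gram 0 0).mul (h.contDiffOn_gram 1 1)).sub
      ((h.contDiffOn_gram 0 1).mul (h.contDiffOn_gram 1 0))
  have hinv := hdet.inv fun y hy => (h.gram_isUnit_det hy).ne_zero
  simp only [Matrix.inv_def, Ring.inverse_eq_inv', Matrix.adjugate_fin_two, Matrix.smul_apply,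
    smul_eq_mul]
  refine hinv.mul ?_
  fin_cases i <;> fin_cases j
  · exact h.contDiffOn_gram 1 1
  · exact (h.contDiffOn_gram 0 1).neg
  · exact (h.contDiffOn_gram 1 0).neg
  · exact h.contDiffOn_gram 0 0

theorem diff_partial_s (h : HasNullNormals U s N N') (hx : x ∈ U) (i : Fin 2) :
    DifferentiableAt ℝ (partialD i s) x := h.diff_ds hx _

theorem diff_partial_partial_s (h : HasNullNormals U s N N') (hx : x ∈ U) (i j : Fin 2) :
    DifferentiableAt ℝ (partialD i (partialD j s)) x :=
  differentiableAt_of_contDiffOn h.isOpen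
    (contDiffOn_partialD h.isOpen (contDiffOn_partialD h.isOpen h.smooth_s j) i) hx

theorem partialD_gram (h : HasNullNormals U s N N') (hx : x ∈ U) (i j k : Fin 2) :
    partialD i (fun y => gram s y j k) x = lor (partialD i (partialD j s) x) (partialD k s x) +
      lor (partialD j s x) (partialD i (partialD k s) x) :=
  partialD_lor (h.diff_partial_s hx j) (h.diff_partial_s hx k) i

/-- For an induced metric the Christoffel symbols are the tangential components of the second
derivatives: in the Koszul expression all other terms cancel by symmetry. -/
theorem christoffel_eq (h : HasNullNormals U s N N') (hx : x ∈ U) (l i j : Fin 2) :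
    christoffel (gram s) l i j x =
      ∑ k, (gram s x)⁻¹ l k * lor (partialD i (partialD j s) x) (partialD k s x) := by
  refine Finset.sum_congr rfl fun k _ => ?_
  congr 1
  rw [h.partialD_gram hx, h.partialD_gram hx, h.partialD_gram hx,
    partialD_comm h.isOpen h.smooth_s hx j i, partialD_comm h.isOpen h.smooth_s hx k i,
    partialD_comm h.isOpen h.smooth_s hx k j,
    lor_comm (partialD j s x) (partialD i (partialD k s) x)]
  rw [lor_comm (partialD i s x) (partialD j (partialD k s) x)]
  ring

theorem sum_gram_christoffel (h : HasNullNormals U s N N') (hx : x ∈ U) (m i j : Fin 2) :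
    ∑ l, gram s x m l * christoffel (gram s) l i j x =
      lor (partialD i (partialD j s) x) (partialD m s x) := by
  have h1 : (gram s x).mulVec ((gram s x)⁻¹.mulVec
      fun k => lor (partialD i (partialD j s) x) (partialD k s x)) =
      fun k => lor (partialD i (partialD j s) x) (partialD k s x) := by
    rw [Matrix.mulVec_mulVec, Matrix.mul_nonsing_inv _ (h.gram_isUnit_det hx), Matrix.one_mulVec]
  have h2 := congrFun h1 m
  rw [← h2]
  simp only [h.christoffel_eq hx]
  rfl

theorem diff_christoffel (h : HasNullNormals U s N N') (hx : x ∈ U) (l i j : Fin 2) :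
    DifferentiableAt ℝ (christoffel (gram s) l i j) x := by
  have h1 : DifferentiableAt ℝ (fun y => ∑ k, (gram s y)⁻¹ l k *
      lor (partialD i (partialD j s) y) (partialD k s y)) x := by
    refine DifferentiableAt.fun_sum fun k _ => ?_
    refine (differentiableAt_of_contDiffOn h.isOpen (h.contDiffOn_gram_inv l k) hx).mul ?_
    exact differentiableAt_of_contDiffOn h.isOpen (contDiffOn_lor
      (contDiffOn_partialD h.isOpen (contDiffOn_partialD h.isOpen h.smooth_s j) i)
      (contDiffOn_partialD h.isOpen h.smooth_s k)) hx
  refine h1.congr_of_eventuallyEq ?_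
  exact Filter.eventuallyEq_of_mem (h.isOpen.mem_nhds hx) fun y hy => h.christoffel_eq hy l i j

/-- Differentiate the lowered relation `sum_gram_christoffel` and antisymmetrize: the third
derivatives of `s` cancel, and the derivative of the inverse Gram matrix never has to be computed.
The right-hand side is the product of second derivatives with their tangential parts removed. -/
theorem sum_gram_riemann (h : HasNullNormals U s N N') (hx : x ∈ U) (m k i j : Fin 2) :
    ∑ l, gram s x m l * riemannTensor (gram s) l k i j x =
      lor (partialD j (partialD k s) x) (partialD i (partialD m s) x) -
      lor (partialD i (partialD k s) x) (partialD j (partialD m s) x) -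
      ∑ l, christoffel (gram s) l j k x * lor (partialD l s x) (partialD i (partialD m s) x) +
      ∑ l, christoffel (gram s) l i k x * lor (partialD l s x) (partialD j (partialD m s) x) := by
  have key : ∀ i j k : Fin 2, ∑ l, (partialD i (fun y => gram s y m l) x *
      christoffel (gram s) l j k x + gram s x m l * partialD i (christoffel (gram s) l j k) x) =
      lor (partialD i (partialD j (partialD k s)) x) (partialD m s x) +
      lor (partialD j (partialD k s) x) (partialD i (partialD m s) x) := by
    intro i j k
    have h1 := partialD_congr h.isOpen (fun y hy => h.sum_gram_christoffel hy m j k) hx i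
    rw [partialD_lor (h.diff_partial_partial_s hx j k) (h.diff_partial_s hx m)] at h1
    rw [← h1, partialD_sum]
    · refine Finset.sum_congr rfl fun l _ => ?_
      rw [partialD_mul]
      · exact differentiableAt_of_contDiffOn h.isOpen (h.contDiffOn_gram m l) hx
      · exact h.diff_christoffel hx l j k
    · intro l
      exact (differentiableAt_of_contDiffOn h.isOpen (h.contDiffOn_gram m l) hx).mul
        (h.diff_christoffel hx l j k)
  have k1 := key i j k
  have k2 := key j i k
  have hsymm := partialD_comm h.isOpen (contDiffOn_partialD h.isOpen h.smooth_s k) hx i j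
  rw [hsymm] at k1
  have c1 : ∀ p, _ := fun p => h.sum_gram_christoffel hx m i p
  have c2 : ∀ p, _ := fun p => h.sum_gram_christoffel hx m j p
  simp only [h.partialD_gram hx, Fin.sum_univ_two, riemannTensor] at k1 k2 c1 c2 ⊢
  rw [lor_comm (partialD 0 s x) (partialD i (partialD m s) x),
    lor_comm (partialD 1 s x) (partialD i (partialD m s) x),
    lor_comm (partialD 0 s x) (partialD j (partialD m s) x),
    lor_comm (partialD 1 s x) (partialD j (partialD m s) x)]
  rw [lor_comm (partialD m s x) (partialD i (partialD 0 s) x),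
    lor_comm (partialD m s x) (partialD i (partialD 1 s) x)] at k1
  rw [lor_comm (partialD m s x) (partialD j (partialD 0 s) x),
    lor_comm (partialD m s x) (partialD j (partialD 1 s) x)] at k2
  linear_combination k1 - k2 + christoffel (gram s) 0 j k x * c1 0 +
    christoffel (gram s) 1 j k x * c1 1 - christoffel (gram s) 0 i k x * c2 0 -
    christoffel (gram s) 1 i k x * c2 1

/-- The `c l` are the tangential components of `X`; what remains is `(⟨X,N'⟩ N + ⟨X,N⟩ N') /
⟨N,N'⟩`, here paired with `Y`. -/
theorem normal_part (h : HasNullNormals U s N N') (hx : x ∈ U) {X : Mink} {c : Fin 2 → ℝ}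
    (hc : ∀ m, ∑ l, gram s x m l * c l = lor X (partialD m s x)) (Y : Mink) :
    lor (N x) (N' x) * (lor X Y - ∑ l, c l * lor (partialD l s x) Y) =
      lor X (N' x) * lor (N x) Y + lor X (N x) * lor (N' x) Y := by
  have h1 : lor (N x) (N' x) • (X - ∑ l, c l • partialD l s x) =
      lor X (N' x) • N x + lor X (N x) • N' x := by
    have c0 := hc 0
    have c1 := hc 1
    have f := h.frame hx
    simp only [Fin.sum_univ_two, gram, Matrix.of_apply] at c0 c1 ⊢
    refine f.eq_of_lor_eq ?_ ?_ ?_ ?_ <;>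
      simp only [lor_add_left, lor_sub_left, lor_smul_left, lor_comm (N x) (partialD _ s x),
        lor_comm (N' x) (partialD _ s x), f.orth_a, f.orth_a', f.orth_b, f.orth_b', f.null, f.null',
        lor_comm (N' x) (N x), lor_comm (partialD 1 s x) (partialD 0 s x)] at c0 c1 ⊢
    · linear_combination -lor (N x) (N' x) * c0
    · linear_combination -lor (N x) (N' x) * c1
    · ring
    · ring
  have h2 := congrArg (fun Z => lor Z Y) h1
  simpa only [lor_add_left, lor_sub_left, lor_smul_left, lor_sum_left] using h2

/-- The Gauss equation. -/
theorem gauss (h : HasNullNormals U s N N') (hx : x ∈ U) (m k i j : Fin 2) :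
    lor (N x) (N' x) * ∑ l, gram s x m l * riemannTensor (gram s) l k i j x =
      lor (partialD j (partialD k s) x) (N x) * lor (partialD i (partialD m s) x) (N' x) +
      lor (partialD j (partialD k s) x) (N' x) * lor (partialD i (partialD m s) x) (N x) -
      lor (partialD i (partialD k s) x) (N x) * lor (partialD j (partialD m s) x) (N' x) -
      lor (partialD i (partialD k s) x) (N' x) * lor (partialD j (partialD m s) x) (N x) := by
  rw [h.sum_gram_riemann hx]
  have h1 := h.normal_part hx (c := fun l => christoffel (gram s) l j k x)
    (fun m => h.sum_gram_christoffel hx m j k) (partialD i (partialD m s) x)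
  have h2 := h.normal_part hx (c := fun l => christoffel (gram s) l i k x)
    (fun m => h.sum_gram_christoffel hx m i k) (partialD j (partialD m s) x)
  rw [lor_comm (N x) (partialD i _ x), lor_comm (N' x) (partialD i _ x)] at h1
  rw [lor_comm (N x) (partialD j _ x), lor_comm (N' x) (partialD j _ x)] at h2
  linear_combination h1 - h2

/-- The induced metric is flat at `x` if and only if the mixed discriminant of
the two shape operators vanishes. -/
theorem flat_iff (h : HasNullNormals U s N N') (hx : x ∈ U) {A A' : E2 →ₗ[ℝ] E2}
    (hA : ∀ v w, pullback (fderiv ℝ s x) (A v) w = pullback (fderiv ℝ s x) (A w) v)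
    (hA' : ∀ v w, pullback (fderiv ℝ s x) (A' v) w = pullback (fderiv ℝ s x) (A' w) v)
    (hN : ∀ v w, lor (fderiv ℝ s x v) (fderiv ℝ N x w) = pullback (fderiv ℝ s x) (A w) v)
    (hN' : ∀ v w, lor (fderiv ℝ s x v) (fderiv ℝ N' x w) = pullback (fderiv ℝ s x) (A' w) v) :
    (∀ l k i j, riemannTensor (gram s) l k i j x = 0) ↔
      ∀ v w, mixedDisc (pullback (fderiv ℝ s x)) A A' v w = 0 := by
  have hb : ∀ i j, lor (partialD i (partialD j s) x) (N x) = -pullback (fderiv ℝ s x)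
      (A (EuclideanSpace.single i 1)) (EuclideanSpace.single j 1) := fun i j => by
    rw [← hN]; exact h.lor_dds_N hx _ _
  have hb' : ∀ i j, lor (partialD i (partialD j s) x) (N' x) = -pullback (fderiv ℝ s x)
      (A' (EuclideanSpace.single i 1)) (EuclideanSpace.single j 1) := fun i j => by
    rw [← hN']; exact h.swap.lor_dds_N hx _ _
  have hG := fun m k i j => h.gauss hx m k i j
  simp only [hb, hb'] at hG
  have s1 := hA (EuclideanSpace.single 0 1) (EuclideanSpace.single 1 1)
  have s1' := hA' (EuclideanSpace.single 0 1) (EuclideanSpace.single 1 1)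
  have hdec : ∀ v : E2, v = v 0 • EuclideanSpace.single (0 : Fin 2) (1 : ℝ) +
      v 1 • EuclideanSpace.single 1 1 := by
    intro v
    ext i
    fin_cases i <;> simp
  constructor
  · intro hR v w
    rw [hdec v, hdec w, mixedDisc_comb hA hA']
    -- A surface has only one independent curvature component, and this one is the mixed
    -- discriminant on the coordinate basis.
    have h1 := hG 0 1 0 1
    simp only [hR, mul_zero, Finset.sum_const_zero] at h1
    rw [mixedDisc]
    rw [← s1, ← s1'] at h1
    linear_combination -((v 0) * (w 1) - (v 1) * (w 0)) ^ 2 * h1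
  · intro hm
    have h1 := hm (EuclideanSpace.single 0 1) (EuclideanSpace.single 1 1)
    rw [mixedDisc] at h1
    have hz : ∀ m k i j, ∑ l, gram s x m l * riemannTensor (gram s) l k i j x = 0 := by
      intro m k i j
      refine (mul_eq_zero.mp ?_).resolve_left (h.cross x hx)
      rw [hG]
      fin_cases i <;> fin_cases j <;> fin_cases k <;> fin_cases m <;>
        simp only [Fin.zero_eta, Fin.mk_one, Fin.isValue, ← s1, ← s1'] <;>
        first | ring1 | linear_combination h1 | linear_combination -h1
    intro l k i j
    have h2 : (gram s x).mulVec (fun l => riemannTensor (gram s) l k i j x) = 0 :=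
      funext fun m => hz m k i j
    have h3 := Matrix.eq_zero_of_mulVec_eq_zero (h.gram_isUnit_det hx).ne_zero h2
    exact congrFun h3 l

/-! ### The Ricci equation -/

theorem lor_normalProj_normal (s : E2 → Mink) (x : E2) (v : Mink) {Z : Mink}
    (hZ : ∀ w, lor (fderiv ℝ s x w) Z = 0) : lor (normalProj s x v) Z = lor v Z := by
  have h1 : ∀ i, lor (partialD i s x) Z = 0 := fun i => hZ _
  simp only [normalProj, lor_sub_left, lor_sum_left, lor_smul_left, h1, mul_zero,
    Finset.sum_const_zero, sub_zero]

theorem exists_sub_normalProj (s : E2 → Mink) (x : E2) (v : Mink) :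
    ∃ c : E2, v - normalProj s x v = fderiv ℝ s x c := by
  refine ⟨∑ i, ∑ j, ((gram s x)⁻¹ i j * lor v (partialD j s x)) • EuclideanSpace.single i 1, ?_⟩
  simp [normalProj, map_smul, partialD]

theorem lor_normalProj_tangent (h : HasNullNormals U s N N') (hx : x ∈ U) (v : Mink) (w : E2) :
    lor (normalProj s x v) (fderiv ℝ s x w) = 0 := by
  have hm : ∀ m, lor (normalProj s x v) (partialD m s x) = 0 := by
    intro m
    have h1 : (gram s x).mulVec ((gram s x)⁻¹.mulVec fun k => lor v (partialD k s x)) =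
        fun k => lor v (partialD k s x) := by
      rw [Matrix.mulVec_mulVec, Matrix.mul_nonsing_inv _ (h.gram_isUnit_det hx),
        Matrix.one_mulVec]
    have h2 := congrFun h1 m
    simp only [Matrix.mulVec, dotProduct, gram, Matrix.of_apply, Fin.sum_univ_two] at h2
    simp only [normalProj, lor_sub_left, lor_smul_left, lor_add_left, gram, Fin.sum_univ_two]
    rw [lor_comm (partialD 0 s x) (partialD m s x), lor_comm (partialD 1 s x) (partialD m s x)]
    linear_combination -h2
  have hw : w = w 0 • EuclideanSpace.single (0 : Fin 2) (1 : ℝ) +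
      w 1 • EuclideanSpace.single 1 1 := by
    ext i
    fin_cases i <;> simp
  rw [hw, map_add, map_smul, map_smul, lor_add_right, lor_smul_right, lor_smul_right]
  rw [show lor (normalProj s x v) (fderiv ℝ s x (EuclideanSpace.single 0 1)) = 0 from hm 0,
    show lor (normalProj s x v) (fderiv ℝ s x (EuclideanSpace.single 1 1)) = 0 from hm 1]
  simp

theorem diff_normalD (h : HasNullNormals U s N N') (hx : x ∈ U) {ξ : E2 → Mink}
    (hξ : ContDiffAt ℝ ∞ ξ x) (j : Fin 2) : DifferentiableAt ℝ (normalD s j ξ) x := by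
  have h1 : DifferentiableAt ℝ (partialD j ξ) x :=
    (((hξ.fderiv_right (m := 1) (by norm_cast)).differentiableAt (by simp)).clm_apply
      (differentiableAt_const _))
  unfold normalD normalProj
  refine h1.sub (DifferentiableAt.fun_sum fun a _ => DifferentiableAt.fun_sum fun b _ => ?_)
  refine DifferentiableAt.fun_smul ?_ (h.diff_partial_s hx a)
  refine (differentiableAt_of_contDiffOn h.isOpen (h.contDiffOn_gram_inv a b) hx).mul ?_
  simp only [← lorL_apply]
  exact ((differentiableAt_const _).clm_apply h1).clm_apply (h.diff_partial_s hx b)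

/-- Differentiate `⟨∇ⱼξ, N⟩ = ⟨∂ⱼξ, N⟩`; the difference is the tangential part of `∂ⱼξ` paired with
`∂ᵢN`, which sees only `A`. The first term on the right is symmetric in `i`, `j`, so the normal
curvature is the antisymmetrization of the second. -/
theorem lor_normalD_normalD (h : HasNullNormals U s N N') (hx : x ∈ U) {ξ : E2 → Mink}
    (hξ : ContDiffAt ℝ ∞ ξ x) {A : E2 →ₗ[ℝ] E2}
    (hN : ∀ v w, lor (fderiv ℝ s x v) (fderiv ℝ N x w) = pullback (fderiv ℝ s x) (A w) v)
    (i j : Fin 2) :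
    lor (normalD s i (normalD s j ξ) x) (N x) = lor (partialD i (partialD j ξ) x) (N x) +
      lor (fderiv ℝ s x (A (EuclideanSpace.single i 1))) (partialD j ξ x) := by
  have hdξ : DifferentiableAt ℝ (partialD j ξ) x :=
    (((hξ.fderiv_right (m := 1) (by norm_cast)).differentiableAt (by simp)).clm_apply
      (differentiableAt_const _))
  have h1 := partialD_lor (h.diff_normalD hx hξ j) (h.diff_N hx) i
  have h2 : partialD i (fun y => lor (normalD s j ξ y) (N y)) x =
      partialD i (fun y => lor (partialD j ξ y) (N y)) x :=
    partialD_congr h.isOpen (fun y hy => lor_normalProj_normal s y _ (h.orth y hy)) hx i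
  rw [h1, partialD_lor hdξ (h.diff_N hx)] at h2
  obtain ⟨c, hc⟩ := exists_sub_normalProj s x (partialD j ξ x)
  have h3 : lor (partialD j ξ x - normalD s j ξ x) (partialD i N x) =
      lor (fderiv ℝ s x (A (EuclideanSpace.single i 1))) (partialD j ξ x) := by
    have h4 := h.lor_normalProj_tangent hx (partialD j ξ x) (A (EuclideanSpace.single i 1))
    have h5 : partialD j ξ x = normalProj s x (partialD j ξ x) + fderiv ℝ s x c := by
      rw [← hc]; abel
    have h6 : lor (fderiv ℝ s x (A (EuclideanSpace.single i 1))) (partialD j ξ x) =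
        lor (fderiv ℝ s x (A (EuclideanSpace.single i 1))) (fderiv ℝ s x c) := by
      rw [lor_comm, h5, lor_add_left, h4, zero_add, lor_comm]
    rw [h6, ← pullback_apply, ← hN]
    exact congrArg (fun Z => lor Z (partialD i N x)) hc
  rw [lor_sub_left] at h3
  have h7 : lor (normalD s i (normalD s j ξ) x) (N x) =
      lor (partialD i (normalD s j ξ) x) (N x) := lor_normalProj_normal s x _ (h.orth x hx)
  rw [h7]
  linarith

/-- The tangential part of `dξ` depends only on the value of `ξ` at the point, being minus the
second derivative of `s` paired with it. Decomposing this value along `N` and `N'` gives `a`, `b`;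
these coefficients are never differentiated. -/
theorem lor_ds_dnormal (h : HasNullNormals U s N N') (hx : x ∈ U) {ξ : E2 → Mink}
    (hξ : IsNormalFieldNear s x ξ) {A A' : E2 →ₗ[ℝ] E2}
    (hN : ∀ v w, lor (fderiv ℝ s x v) (fderiv ℝ N x w) = pullback (fderiv ℝ s x) (A w) v)
    (hN' : ∀ v w, lor (fderiv ℝ s x v) (fderiv ℝ N' x w) = pullback (fderiv ℝ s x) (A' w) v) :
    ∃ a b : ℝ, ∀ v j, lor (fderiv ℝ s x v) (partialD j ξ x) = pullback (fderiv ℝ s x)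
      (a • A (EuclideanSpace.single j 1) + b • A' (EuclideanSpace.single j 1)) v := by
  have hdiff : DifferentiableAt ℝ ξ x := hξ.1.differentiableAt (by simp)
  have hnorm : ∀ᶠ y in 𝓝 x, ∀ v, lor (fderiv ℝ s y v) (ξ y) = 0 := by
    filter_upwards [hξ.2] with y hy v
    have hv : v = v 0 • EuclideanSpace.single (0 : Fin 2) (1 : ℝ) +
        v 1 • EuclideanSpace.single 1 1 := by
      ext i
      fin_cases i <;> simp
    have h0 := hy 0
    have h1 := hy 1
    rw [lor_comm] at h0 h1
    simp only [partialD] at h0 h1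
    rw [hv, map_add, map_smul, map_smul, lor_add_left, lor_smul_left, lor_smul_left, h0, h1]
    simp
  have hder : ∀ v j, lor (fderiv ℝ s x v) (partialD j ξ x) =
      -lor (fderiv ℝ (fun y => fderiv ℝ s y v) x (EuclideanSpace.single j 1)) (ξ x) := by
    intro v j
    have h1 : (fun y => lor (fderiv ℝ s y v) (ξ y)) =ᶠ[𝓝 x] fun _ => 0 :=
      hnorm.mono fun y hy => hy v
    have h2 := fderiv_lor (h.diff_ds hx v) hdiff (EuclideanSpace.single j 1)
    rw [h1.fderiv_eq] at h2
    simp at h2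
    simp only [partialD]
    linarith
  have hdec : ξ x = (lor (ξ x) (N' x) / lor (N x) (N' x)) • N x +
      (lor (ξ x) (N x) / lor (N x) (N' x)) • N' x := by
    have hc := h.cross x hx
    refine h.eq_of_lor_eq hx (fun v => ?_) ?_ ?_
    · rw [lor_comm, hnorm.self_of_nhds v, lor_comm, lor_add_right, lor_smul_right, lor_smul_right,
        h.orth x hx, h.orth' x hx]
      simp
    · rw [lor_add_left, lor_smul_left, lor_smul_left, h.null x hx, lor_comm (N' x) (N x)]
      field_simp
      ring
    · rw [lor_add_left, lor_smul_left, lor_smul_left, h.null' x hx]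
      field_simp
      ring
  refine ⟨lor (ξ x) (N' x) / lor (N x) (N' x), lor (ξ x) (N x) / lor (N x) (N' x),
    fun v j => ?_⟩
  rw [hder, hdec, lor_add_right, lor_smul_right, lor_smul_right, h.lor_dds_N hx,
    h.swap.lor_dds_N hx, hN, hN', ← hdec]
  simp only [map_add, map_smul, LinearMap.add_apply, LinearMap.smul_apply, smul_eq_mul]
  ring

theorem partialD_comm_at {ξ : E2 → Mink} (hξ : ContDiffAt ℝ ∞ ξ x) (i j : Fin 2) :
    partialD i (partialD j ξ) x = partialD j (partialD i ξ) x := by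
  have hd := (hξ.fderiv_right (m := 1) (by norm_cast)).differentiableAt (by simp)
  have hs := hξ.isSymmSndFDerivAt
    (by simp only [minSmoothness_of_isRCLikeNormedField]; norm_cast)
  unfold partialD
  rw [fderiv_clm_apply hd (differentiableAt_const _), fderiv_clm_apply hd (differentiableAt_const _)]
  simpa using hs.eq _ _

/-- The normal bundle is flat at `x` if and only if the two shape operators commute. -/
theorem normal_flat_iff (h : HasNullNormals U s N N') (hx : x ∈ U) {A A' : E2 →ₗ[ℝ] E2}
    (hA : ∀ v w, pullback (fderiv ℝ s x) (A v) w = pullback (fderiv ℝ s x) (A w) v)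
    (hA' : ∀ v w, pullback (fderiv ℝ s x) (A' v) w = pullback (fderiv ℝ s x) (A' w) v)
    (hN : ∀ v w, lor (fderiv ℝ s x v) (fderiv ℝ N x w) = pullback (fderiv ℝ s x) (A w) v)
    (hN' : ∀ v w, lor (fderiv ℝ s x v) (fderiv ℝ N' x w) = pullback (fderiv ℝ s x) (A' w) v) :
    (∀ ξ : E2 → Mink, IsNormalFieldNear s x ξ → ∀ i j : Fin 2,
      normalD s i (normalD s j ξ) x = normalD s j (normalD s i ξ) x) ↔
      ∀ v, A (A' v) = A' (A v) := by
  have hg := h.isScalarProduct hx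
  set g := pullback (fderiv ℝ s x) with hgdef
  constructor
  · intro hflat
    -- The normal bundle has rank two, so testing the curvature on `ξ = N'` against `N` is enough.
    have hN'normal : IsNormalFieldNear s x N' := by
      refine ⟨h.smooth_N'.contDiffAt (h.isOpen.mem_nhds hx), ?_⟩
      filter_upwards [h.isOpen.mem_nhds hx] with y hy i
      rw [lor_comm]
      exact h.orth' y hy _
    have h1 : ∀ i j : Fin 2, g (A' (EuclideanSpace.single j 1)) (A (EuclideanSpace.single i 1)) =
        g (A' (EuclideanSpace.single i 1)) (A (EuclideanSpace.single j 1)) := by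
      intro i j
      have h2 := congrArg (fun Z => lor Z (N x)) (hflat N' hN'normal i j)
      rw [h.lor_normalD_normalD hx hN'normal.1 hN, h.lor_normalD_normalD hx hN'normal.1 hN,
        partialD_comm_at hN'normal.1 i j] at h2
      simp only [partialD, hN'] at h2
      linarith
    have hcomm : ∀ i : Fin 2, A (A' (EuclideanSpace.single i 1)) =
        A' (A (EuclideanSpace.single i 1)) := by
      intro i
      refine hg.eq_of_forall fun w => ?_
      have hw : w = w 0 • EuclideanSpace.single (0 : Fin 2) (1 : ℝ) +
          w 1 • EuclideanSpace.single 1 1 := by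
        ext i
        fin_cases i <;> simp
      have h2 : ∀ j : Fin 2, g (A (A' (EuclideanSpace.single i 1))) (EuclideanSpace.single j 1) =
          g (A' (A (EuclideanSpace.single i 1))) (EuclideanSpace.single j 1) := by
        intro j
        rw [hA, hA', hg.symm, h1, hg.symm, hg.symm (A _), h1, hg.symm]
      rw [hw, map_add, map_add, map_smul, map_smul, map_smul, map_smul, h2, h2]
    intro v
    have hv : v = v 0 • EuclideanSpace.single (0 : Fin 2) (1 : ℝ) +
        v 1 • EuclideanSpace.single 1 1 := by
      ext i
      fin_cases i <;> simp
    rw [hv]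
    simp only [map_add, map_smul, hcomm]
  · intro hcomm ξ hξ i j
    obtain ⟨a, b, hab⟩ := h.lor_ds_dnormal hx hξ hN hN'
    -- Commuting self-adjoint operators have a self-adjoint product; this symmetry makes the cross
    -- terms of the curvature cancel.
    have hsw : ∀ v w, g (A' v) (A w) = g (A' w) (A v) := by
      intro v w
      rw [hA', ← hcomm, hA, hg.symm]
    refine h.eq_of_lor_eq hx (fun v => ?_) ?_ ?_
    · simp only [normalD]
      rw [h.lor_normalProj_tangent hx, h.lor_normalProj_tangent hx]
    · rw [h.lor_normalD_normalD hx hξ.1 hN, h.lor_normalD_normalD hx hξ.1 hN,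
        partialD_comm_at hξ.1 i j, hab, hab]
      simp only [map_add, map_smul, LinearMap.add_apply, LinearMap.smul_apply, smul_eq_mul]
      rw [← hgdef, hg.symm (A _) (A (EuclideanSpace.single i 1)),
        hsw (EuclideanSpace.single j 1) (EuclideanSpace.single i 1)]
    · rw [h.swap.lor_normalD_normalD hx hξ.1 hN', h.swap.lor_normalD_normalD hx hξ.1 hN',
        partialD_comm_at hξ.1 i j, hab, hab]
      simp only [map_add, map_smul, LinearMap.add_apply, LinearMap.smul_apply, smul_eq_mul]
      rw [← hgdef, hg.symm (A' _) (A' (EuclideanSpace.single i 1)),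
        hg.symm (A (EuclideanSpace.single j 1)), hg.symm (A (EuclideanSpace.single i 1)),
        hsw (EuclideanSpace.single j 1) (EuclideanSpace.single i 1)]

end HasNullNormals

/-! ### Reflections of Minkowski space -/

/-- The reflection in the orthogonal complement of `D`. -/
def lorReflection (D : Mink) : Mink →ₗ[ℝ] Mink where
  toFun u := u - (2 * (lor u D / lor D D)) • D
  map_add' u v := by
    rw [lor_add_left, add_div, mul_add, add_smul]
    abel
  map_smul' c u := by
    rw [lor_smul_left, RingHom.id_apply, smul_sub, smul_smul]
    congr 2
    ring

theorem lorReflection_apply (D u : Mink) :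
    lorReflection D u = u - (2 * (lor u D / lor D D)) • D := rfl

theorem lor_lorReflection {D : Mink} (hD : lor D D ≠ 0) (u v : Mink) :
    lor (lorReflection D u) (lorReflection D v) = lor u v := by
  simp only [lorReflection_apply, lor_sub_left, lor_sub_right, lor_smul_left, lor_smul_right]
  rw [lor_comm D v]
  field_simp
  ring

theorem lorReflection_of_orth {D u : Mink} (h : lor u D = 0) : lorReflection D u = u := by
  simp [lorReflection_apply, h]

/-- The reflection in the difference of two null vectors interchanges them. -/
theorem lorReflection_null {P Q : Mink} (hP : lor P P = 0) (hQ : lor Q Q = 0)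
    (hPQ : lor P Q ≠ 0) : lorReflection (Q - P) P = Q := by
  have h1 : lor P (Q - P) = lor P Q := by rw [lor_sub_right, hP, sub_zero]
  have h2 : lor (Q - P) (Q - P) = -(2 * lor P Q) := by
    simp only [lor_sub_left, lor_sub_right, hP, hQ, lor_comm Q P]
    ring
  have h3 : 2 * (lor P Q / -(2 * lor P Q)) = -1 := by field_simp
  rw [lorReflection_apply, h1, h2, h3]
  simp

/-! ### Null normal fields with proportional shape operators -/

namespace HasNullNormals

variable {U : Set E2} {s N Q : E2 → Mink}

/-- If the two null normal fields have the same shape operator, then their difference moves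
in a fixed direction. -/
theorem fderiv_sub_of_shape_eq (h : HasNullNormals U s N Q)
    (heq : ∀ y ∈ U, ∀ v w, lor (fderiv ℝ s y v) (fderiv ℝ Q y w) =
      lor (fderiv ℝ s y v) (fderiv ℝ N y w))
    (hnd : ∀ y ∈ U, ∀ w, (∀ v, lor (fderiv ℝ s y v) (fderiv ℝ N y w) = 0) → w = 0)
    {x : E2} (hx : x ∈ U) (w : E2) :
    ∃ c : ℝ, fderiv ℝ (fun y => Q y - N y) x w = c • (Q x - N x) := by
  -- The tangential parts of `dQ` and `dN` agree and cancel, so `dD = θ' Q - θ N` for `D = Q - N`.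
  have hD : ∀ y ∈ U, ∀ w, fderiv ℝ (fun y => Q y - N y) y w =
      (lor (fderiv ℝ Q y w) (N y) / lor (Q y) (N y)) • Q y -
        (lor (fderiv ℝ N y w) (Q y) / lor (N y) (Q y)) • N y := by
    intro y hy w
    obtain ⟨A, -, hA, hAN⟩ := h.exists_shape hy
    obtain ⟨A', -, hA', hAQ⟩ := h.swap.exists_shape hy
    have hAA : A' w = A w := (h.isScalarProduct hy).eq_of_forall fun v => by
      rw [← hA', ← hA, heq y hy]
    rw [fderiv_fun_sub (h.swap.diff_N hy) (h.diff_N hy), sub_apply]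
    conv_lhs => rw [hAN, hAQ, hAA]
    rw [add_sub_add_left_eq_sub]
  set θ : E2 → ℝ := fun w => lor (fderiv ℝ N x w) (Q x) / lor (N x) (Q x) with hθ
  set θ' : E2 → ℝ := fun w => lor (fderiv ℝ Q x w) (N x) / lor (Q x) (N x) with hθ'
  have hsmooth : ContDiffOn ℝ ∞ (fun y => Q y - N y) U := h.smooth_N'.sub h.smooth_N
  have hdD : ∀ w, DifferentiableAt ℝ (fun y => fderiv ℝ (fun y => Q y - N y) y w) x := fun w =>
    differentiableAt_of_contDiffOn h.isOpen (contDiffOn_fderiv_apply h.isOpen hsmooth w) hx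
  -- Derivative of `⟨dD w, ds v⟩ = 0` in the direction `u`.
  have hkey : ∀ u v w, (θ w - θ' w) * lor (fderiv ℝ s x v) (fderiv ℝ N x u) =
      -lor (fderiv ℝ (fun y => fderiv ℝ (fun y => Q y - N y) y w) x u) (fderiv ℝ s x v) := by
    intro u v w
    have h1 : (fun y => lor (fderiv ℝ (fun y => Q y - N y) y w) (fderiv ℝ s y v)) =ᶠ[𝓝 x]
        fun _ => 0 := by
      refine Filter.eventuallyEq_of_mem (h.isOpen.mem_nhds hx) fun y hy => ?_
      rw [hD y hy, lor_comm, lor_sub_right, lor_smul_right, lor_smul_right, h.orth y hy,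
        h.orth' y hy]
      simp
    have h2 := fderiv_lor (hdD w) (h.diff_ds hx v) u
    rw [h1.fderiv_eq, hD x hx, lor_sub_left, lor_smul_left, lor_smul_left, lor_comm (Q x) (fderiv ℝ _ x u),
      lor_comm (N x) (fderiv ℝ _ x u), h.lor_dds_N hx, h.swap.lor_dds_N hx, heq x hx] at h2
    simp at h2
    simp only [hθ, hθ']
    linarith
  -- Second derivatives of `D` are symmetric in `u` and `w`, and the shape operator has no kernel.
  have hη : ∀ u w, (θ w - θ' w) • u = (θ u - θ' u) • w := by
    intro u w
    refine sub_eq_zero.mp (hnd x hx _ fun v => ?_)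
    rw [map_sub, map_smul, map_smul, lor_sub_right, lor_smul_right, lor_smul_right, hkey, hkey,
      fderiv_fderiv_comm h.isOpen hsmooth hx]
    ring
  -- Otherwise both coordinate vectors would be multiples of `w`, which is impossible in a plane.
  have hzero : θ w - θ' w = 0 := by
    by_contra hne
    have h0 := hη (EuclideanSpace.single 0 1) w
    have h1 := hη (EuclideanSpace.single 1 1) w
    have a0 := congrArg (fun v : E2 => v 0) h0
    have a1 := congrArg (fun v : E2 => v 1) h0
    have b0 := congrArg (fun v : E2 => v 0) h1
    have b1 := congrArg (fun v : E2 => v 1) h1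
    simp only [PiLp.smul_apply, smul_eq_mul, PiLp.single_apply, Fin.isValue, if_true,
      one_ne_zero, zero_ne_one, if_false, mul_one, mul_zero] at a0 a1 b0 b1
    rcases mul_eq_zero.mp b0.symm with h | h
    · rw [h, zero_mul] at b1; exact hne b1
    · rw [h, mul_zero] at a0; exact hne a0
  refine ⟨θ w, ?_⟩
  rw [hD x hx, smul_sub, show θ w = θ' w by linarith]
  congr 2
  simp only [hθ, hθ'] at hzero
  linarith

/-- If the two null normal fields have the same shape operator, then some reflection of Minkowski
space maps one to the other, and acts on the surface as a translation. -/
theorem exists_reflection_of_shape_eq (h : HasNullNormals U s N Q) (hU : Convex ℝ U)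
    (heq : ∀ y ∈ U, ∀ v w, lor (fderiv ℝ s y v) (fderiv ℝ Q y w) =
      lor (fderiv ℝ s y v) (fderiv ℝ N y w))
    (hnd : ∀ y ∈ U, ∀ w, (∀ v, lor (fderiv ℝ s y v) (fderiv ℝ N y w) = 0) → w = 0)
    {x₀ : E2} (hx₀ : x₀ ∈ U) :
    ∃ (R : Mink →ₗ[ℝ] Mink) (b : Mink), (∀ u v, lor (R u) (R v) = lor u v) ∧
      ∀ y ∈ U, R (N y) = Q y ∧ R (s y) + b = s y := by
  set D : E2 → Mink := fun y => Q y - N y with hDdef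
  have hDsmooth : ContDiffOn ℝ ∞ D U := h.smooth_N'.sub h.smooth_N
  have hDD : ∀ y ∈ U, lor (D y) (D y) ≠ 0 := by
    intro y hy
    simp only [hDdef, lor_sub_left, lor_sub_right, h.null y hy, h.null' y hy, lor_comm (Q y) (N y)]
    have := h.cross y hy
    intro h0
    exact this (by linarith)
  -- The reflection depends only on the line of `D`, and `dD = c D` keeps this line fixed:
  -- infinitesimally, the coefficient changes by the factor `-c` and `D` by `c`.
  have hconst : ∀ u, ∀ y ∈ U, lorReflection (D x₀) u = lorReflection (D y) u := by
    intro u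
    have hdiff : ∀ y ∈ U, DifferentiableAt ℝ (fun y => (2 * (lor u (D y) / lor (D y) (D y))) • D y) y ∧
        fderiv ℝ (fun y => (2 * (lor u (D y) / lor (D y) (D y))) • D y) y = 0 := by
      intro y hy
      have hd := differentiableAt_of_contDiffOn h.isOpen hDsmooth hy
      have hnum : DifferentiableAt ℝ (fun y => lor u (D y)) y :=
        differentiableAt_of_contDiffOn h.isOpen (contDiffOn_lor contDiffOn_const hDsmooth) hy
      have hden : DifferentiableAt ℝ (fun y => lor (D y) (D y)) y :=
        differentiableAt_of_contDiffOn h.isOpen (contDiffOn_lor hDsmooth hDsmooth) hy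
      have hr : DifferentiableAt ℝ (fun y => lor u (D y) / lor (D y) (D y)) y := by
        simp only [div_eq_mul_inv]
        exact hnum.mul (hden.inv (hDD y hy))
      have hq : DifferentiableAt ℝ (fun y => 2 * (lor u (D y) / lor (D y) (D y))) y :=
        hr.const_mul 2
      refine ⟨hq.fun_smul hd, ?_⟩
      ext1 w
      obtain ⟨c, hc⟩ : ∃ c : ℝ, fderiv ℝ D y w = c • D y :=
        h.fderiv_sub_of_shape_eq heq hnd hy w
      have hne := hDD y hy
      have hn' : fderiv ℝ (fun y => lor u (D y)) y w = c * lor u (D y) := by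
        rw [fderiv_lor (differentiableAt_const u) hd, hc, lor_smul_right]
        simp
      have hd' : fderiv ℝ (fun y => lor (D y) (D y)) y w = 2 * c * lor (D y) (D y) := by
        rw [fderiv_lor hd hd, hc, lor_smul_right, lor_smul_left]
        ring
      have hq' : fderiv ℝ (fun y => lor u (D y) / lor (D y) (D y)) y w =
          -c * (lor u (D y) / lor (D y) (D y)) := by
        -- The derivative of the quotient is read off from the product rule for quotient times
        -- denominator.
        have e1 : fderiv ℝ (fun y => lor u (D y)) y w = fderiv ℝ (fun y =>
            (lor u (D y) / lor (D y) (D y)) * lor (D y) (D y)) y w := by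
          congr 1
          refine Filter.EventuallyEq.fderiv_eq
            (Filter.eventuallyEq_of_mem (h.isOpen.mem_nhds hy) fun z hz => ?_)
          exact (div_mul_cancel₀ _ (hDD z hz)).symm
        rw [fderiv_fun_mul hr hden] at e1
        simp only [add_apply, smul_apply, smul_eq_mul,
          hn', hd'] at e1
        have e2 : lor u (D y) = lor u (D y) / lor (D y) (D y) * lor (D y) (D y) :=
          (div_mul_cancel₀ _ hne).symm
        refine mul_left_cancel₀ hne ?_
        linear_combination -e1 + c * e2
      rw [fderiv_fun_smul hq hd]
      simp only [add_apply, smul_apply,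
        ContinuousLinearMap.smulRight_apply, zero_apply, hc]
      rw [fderiv_const_mul hr, smul_apply]
      rw [hq', smul_smul, ← add_smul, smul_eq_mul]
      ring_nf
      simp
    intro y hy
    have := h.isOpen.is_const_of_fderiv_eq_zero hU.isPreconnected
      (fun z hz => (hdiff z hz).1.differentiableWithinAt) (fun z hz => (hdiff z hz).2) hx₀ hy
    rw [lorReflection_apply, lorReflection_apply, this]
  -- Tangent vectors of `s` are orthogonal to `D` and hence fixed by the reflection, so `s - R s`
  -- has zero derivative.
  have htr : ∀ y ∈ U, s x₀ - lorReflection (D x₀) (s x₀) = s y - lorReflection (D x₀) (s y) := by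
    intro y hy
    let RL : Mink →L[ℝ] Mink := LinearMap.toContinuousLinearMap (lorReflection (D x₀))
    have hdiff : ∀ z ∈ U, HasFDerivAt (fun z => s z - RL (s z)) (0 : E2 →L[ℝ] Mink) z := by
      intro z hz
      have h1 := (h.diff_s hz).hasFDerivAt
      have h2 := h1.sub (RL.hasFDerivAt.comp z h1)
      refine h2.congr_fderiv ?_
      ext1 v
      have h3 : lorReflection (D z) (fderiv ℝ s z v) = fderiv ℝ s z v :=
        lorReflection_of_orth (by
          simp only [hDdef]
          rw [lor_sub_right, h.orth z hz, h.orth' z hz, sub_zero])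
      rw [← hconst _ z hz] at h3
      simp [RL, h3]
    exact h.isOpen.is_const_of_fderiv_eq_zero hU.isPreconnected
      (fun z hz => (hdiff z hz).differentiableAt.differentiableWithinAt)
      (fun z hz => (hdiff z hz).fderiv) hx₀ hy
  refine ⟨lorReflection (D x₀), s x₀ - lorReflection (D x₀) (s x₀),
    lor_lorReflection (hDD x₀ hx₀), fun y hy => ⟨?_, ?_⟩⟩
  · rw [hconst _ y hy]
    exact lorReflection_null (h.null y hy) (h.null' y hy) (h.cross y hy)
  · rw [htr y hy]
    abel

/-- If the shape operators of the two null normal fields are proportional, then some isometry of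
Minkowski space maps one null normal line to the other. -/
theorem exists_isometry_of_shape_proportional {N' : E2 → Mink} (h : HasNullNormals U s N N')
    (hU : Convex ℝ U)
    (hprop : ∀ y ∈ U, ∃ l : ℝ, l ≠ 0 ∧ ∀ v w, lor (fderiv ℝ s y v) (fderiv ℝ N' y w) =
      l * lor (fderiv ℝ s y v) (fderiv ℝ N y w))
    (hnd : ∀ y ∈ U, ∀ w, (∀ v, lor (fderiv ℝ s y v) (fderiv ℝ N y w) = 0) → w = 0)
    {x₀ : E2} (hx₀ : x₀ ∈ U) :
    ∃ (R : Mink →ₗ[ℝ] Mink) (b : Mink), (∀ u v, lor (R u) (R v) = lor u v) ∧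
      ∀ y ∈ U, (∃ c : ℝ, c ≠ 0 ∧ R (N y) = c • N' y) ∧ R (s y) + b = s y := by
  choose! l hl0 hl using hprop
  -- The factor `l` was merely chosen pointwise; near each point it is a quotient of two smooth
  -- entries whose denominator does not vanish.
  have hlsmooth : ContDiffOn ℝ ∞ l U := by
    intro y hy
    refine ContDiffAt.contDiffWithinAt ?_
    obtain ⟨v, w, hvw⟩ : ∃ v w, lor (fderiv ℝ s y v) (fderiv ℝ N y w) ≠ 0 := by
      by_contra! hcon
      have h1 := hnd y hy (EuclideanSpace.single 0 1) fun v => hcon v _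
      have h2 := congrArg (fun v : E2 => v 0) h1
      simp at h2
    have hB : ContDiffAt ℝ ∞ (fun y => lor (fderiv ℝ s y v) (fderiv ℝ N y w)) y :=
      (contDiffOn_lor (contDiffOn_fderiv_apply h.isOpen h.smooth_s v)
        (contDiffOn_fderiv_apply h.isOpen h.smooth_N w)).contDiffAt (h.isOpen.mem_nhds hy)
    have hB' : ContDiffAt ℝ ∞ (fun y => lor (fderiv ℝ s y v) (fderiv ℝ N' y w)) y :=
      (contDiffOn_lor (contDiffOn_fderiv_apply h.isOpen h.smooth_s v)
        (contDiffOn_fderiv_apply h.isOpen h.smooth_N' w)).contDiffAt (h.isOpen.mem_nhds hy)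
    refine (hB'.div hB hvw).congr_of_eventuallyEq ?_
    filter_upwards [hB.continuousAt.eventually_ne hvw, h.isOpen.mem_nhds hy] with z hz hzU
    rw [Pi.div_apply, hl z hzU, mul_div_assoc, div_self hz, mul_one]
  have hinv : ContDiffOn ℝ ∞ (fun y => (l y)⁻¹) U := hlsmooth.inv hl0
  have hQ : HasNullNormals U s N (fun y => (l y)⁻¹ • N' y) :=
    { h with
      smooth_N' := hinv.smul h.smooth_N'
      null' := fun y hy => by rw [lor_smul_left, lor_smul_right, h.null' y hy]; simp
      cross := fun y hy => by
        rw [lor_smul_right]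
        exact mul_ne_zero (inv_ne_zero (hl0 y hy)) (h.cross y hy)
      orth' := fun y hy v => by rw [lor_smul_right, h.orth' y hy, mul_zero] }
  have heq : ∀ y ∈ U, ∀ v w, lor (fderiv ℝ s y v) (fderiv ℝ (fun y => (l y)⁻¹ • N' y) y w) =
      lor (fderiv ℝ s y v) (fderiv ℝ N y w) := by
    intro y hy v w
    -- The derivative of the factor only contributes a multiple of `N'`, invisible to tangent
    -- vectors.
    rw [fderiv_fun_smul (differentiableAt_of_contDiffOn h.isOpen hinv hy) (h.swap.diff_N hy)]
    simp only [add_apply, smul_apply,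
      ContinuousLinearMap.smulRight_apply, lor_add_right, lor_smul_right, hl y hy, h.orth' y hy]
    rw [mul_zero, add_zero, inv_mul_cancel_left₀ (hl0 y hy)]
  obtain ⟨R, b, hR, hRb⟩ := hQ.exists_reflection_of_shape_eq hU heq hnd hx₀
  exact ⟨R, b, hR, fun y hy => ⟨⟨(l y)⁻¹, inv_ne_zero (hl0 y hy), (hRb y hy).1⟩, (hRb y hy).2⟩⟩

end HasNullNormals

/-! ### Null normal fields from unit vector fields -/

theorem lor_neg_one (u : Mink) (n : E3) : lor u (-n, 1) = -(inner ℝ u.1 n) - u.2 := by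
  simp [lor]

theorem hasNullNormals_of_unit {U : Set E2} (hU : IsOpen U) {s : E2 → Mink}
    (hs : ContDiffOn ℝ ∞ s U)
    (hsp : ∀ x ∈ U, ∀ v ≠ 0, 0 < lor (fderiv ℝ s x v) (fderiv ℝ s x v))
    {n n' : E2 → E3} (hn : ContDiffOn ℝ ∞ n U) (hn' : ContDiffOn ℝ ∞ n' U)
    (hunit : ∀ x ∈ U, ‖n x‖ = 1) (hunit' : ∀ x ∈ U, ‖n' x‖ = 1) (hne : ∀ x ∈ U, n x ≠ n' x)
    (horth : ∀ x ∈ U, ∀ v, lor (fderiv ℝ s x v) (-n x, 1) = 0)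
    (horth' : ∀ x ∈ U, ∀ v, lor (fderiv ℝ s x v) (-n' x, 1) = 0) :
    HasNullNormals U s (fun x => (-n x, 1)) (fun x => (-n' x, 1)) where
  isOpen := hU
  smooth_s := hs
  smooth_N := hn.neg.prodMk contDiffOn_const
  smooth_N' := hn'.neg.prodMk contDiffOn_const
  spacelike := hsp
  null x hx := by simp [lor, hunit x hx]
  null' x hx := by simp [lor, hunit' x hx]
  cross x hx := by
    -- The product is `n · n' - 1`, zero only for equal unit vectors.
    simp only [lor, inner_neg_left, inner_neg_right, neg_neg, mul_one]
    rw [sub_ne_zero, Ne, inner_eq_one_iff_of_norm_eq_one (hunit x hx) (hunit' x hx)]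
    exact hne x hx
  orth := horth
  orth' := horth'

/-! ### Explicit null normals of a space-like plane -/

/-- The vector product of Euclidean space. -/
def cross (a b : E3) : E3 :=
  !₂[a 1 * b 2 - a 2 * b 1, a 2 * b 0 - a 0 * b 2, a 0 * b 1 - a 1 * b 0]

theorem inner_cross_left (a b : E3) : inner ℝ a (cross a b) = 0 := by
  simp [cross, PiLp.inner_apply, Fin.sum_univ_three]; ring

theorem inner_cross_right (a b : E3) : inner ℝ b (cross a b) = 0 := by
  simp [cross, PiLp.inner_apply, Fin.sum_univ_three]; ring

theorem inner_cross_self (a b : E3) : inner ℝ (cross a b) (cross a b) =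
    inner ℝ a a * inner ℝ b b - inner ℝ a b ^ 2 := by
  simp only [cross, PiLp.inner_apply, Fin.sum_univ_three]
  simp
  ring

theorem contDiffOn_cross {U : Set E2} {a b : E2 → E3} (ha : ContDiffOn ℝ ∞ a U)
    (hb : ContDiffOn ℝ ∞ b U) : ContDiffOn ℝ ∞ (fun x => cross (a x) (b x)) U := by
  rw [contDiffOn_euclidean] at ha hb ⊢
  intro i
  fin_cases i
  · exact ((ha 1).mul (hb 2)).sub ((ha 2).mul (hb 1))
  · exact ((ha 2).mul (hb 0)).sub ((ha 0).mul (hb 2))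
  · exact ((ha 0).mul (hb 1)).sub ((ha 1).mul (hb 0))

/-- For `e = √G` and `e = -√G`, with `G` the Gram determinant of `u` and `v`, the two vectors `n`
such that `(-n, 1)` is a null vector orthogonal to `u` and `v`. -/
def nullNormal (u v : Mink) (e : ℝ) : E3 :=
  (inner ℝ u.1 u.1 * inner ℝ v.1 v.1 - inner ℝ u.1 v.1 ^ 2)⁻¹ •
    ((v.2 * inner ℝ u.1 v.1 - u.2 * inner ℝ v.1 v.1) • u.1 +
      (u.2 * inner ℝ u.1 v.1 - v.2 * inner ℝ u.1 u.1) • v.1 + e • cross u.1 v.1)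

section NullNormal

variable {u v : Mink} {e : ℝ}

theorem inner_nullNormal_left
    (hW : inner ℝ u.1 u.1 * inner ℝ v.1 v.1 - inner ℝ u.1 v.1 ^ 2 ≠ 0) :
    inner ℝ u.1 (nullNormal u v e) = -u.2 := by
  rw [nullNormal, inner_smul_right, inner_add_right, inner_add_right, inner_smul_right,
    inner_smul_right, inner_smul_right, inner_cross_left]
  field_simp
  ring

theorem inner_nullNormal_right
    (hW : inner ℝ u.1 u.1 * inner ℝ v.1 v.1 - inner ℝ u.1 v.1 ^ 2 ≠ 0) :
    inner ℝ v.1 (nullNormal u v e) = -v.2 := by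
  rw [nullNormal, inner_smul_right, inner_add_right, inner_add_right, inner_smul_right,
    inner_smul_right, inner_smul_right, inner_cross_right, real_inner_comm u.1 v.1]
  field_simp
  ring

theorem inner_cross_nullNormal
    (hW : inner ℝ u.1 u.1 * inner ℝ v.1 v.1 - inner ℝ u.1 v.1 ^ 2 ≠ 0) :
    inner ℝ (cross u.1 v.1) (nullNormal u v e) = e := by
  rw [nullNormal, inner_smul_right, inner_add_right, inner_add_right, inner_smul_right,
    inner_smul_right, inner_smul_right, real_inner_comm u.1 (cross _ _), inner_cross_left,
    real_inner_comm v.1 (cross _ _), inner_cross_right, inner_cross_self]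
  field_simp
  ring

/-- The products with `u.1` and `v.1` are already fixed by orthogonality, so the length depends only
on the cross product coefficient `e`; unit length amounts to `e ^ 2` being the Lorentzian Gram
determinant. -/
theorem norm_nullNormal
    (hW : inner ℝ u.1 u.1 * inner ℝ v.1 v.1 - inner ℝ u.1 v.1 ^ 2 ≠ 0)
    (he : e ^ 2 = lor u u * lor v v - lor u v ^ 2) : ‖nullNormal u v e‖ = 1 := by
  have h1 : inner ℝ (nullNormal u v e) (nullNormal u v e) = (1 : ℝ) := by
    conv_lhs => arg 2; rw [nullNormal]
    rw [inner_smul_left, inner_add_left, inner_add_left, inner_smul_left, inner_smul_left,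
      inner_smul_left, inner_nullNormal_left hW, inner_nullNormal_right hW,
      inner_cross_nullNormal hW]
    simp only [lor] at he
    simp only [conj_trivial]
    field_simp
    linear_combination he
  rw [real_inner_self_eq_norm_sq] at h1
  nlinarith [norm_nonneg (nullNormal u v e)]

end NullNormal

/-- A space-like surface has two smooth null normal fields. -/
theorem exists_null_normals {U : Set E2} (hU : IsOpen U) {s : E2 → Mink}
    (hs : ContDiffOn ℝ ∞ s U)
    (hsp : ∀ x ∈ U, ∀ v ≠ 0, 0 < lor (fderiv ℝ s x v) (fderiv ℝ s x v)) :
    ∃ n n' : E2 → E3, ContDiffOn ℝ ∞ n U ∧ ContDiffOn ℝ ∞ n' U ∧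
      (∀ x ∈ U, ‖n x‖ = 1) ∧ (∀ x ∈ U, ‖n' x‖ = 1) ∧ (∀ x ∈ U, n x ≠ n' x) ∧
      (∀ x ∈ U, ∀ v, lor (fderiv ℝ s x v) (-n x, 1) = 0) ∧
      ∀ x ∈ U, ∀ v, lor (fderiv ℝ s x v) (-n' x, 1) = 0 := by
  set u := partialD 0 s with hu
  set v := partialD 1 s with hv
  have hus : ContDiffOn ℝ ∞ u U := contDiffOn_partialD hU hs 0
  have hvs : ContDiffOn ℝ ∞ v U := contDiffOn_partialD hU hs 1
  set G : E2 → ℝ := fun x => lor (u x) (u x) * lor (v x) (v x) - lor (u x) (v x) ^ 2 with hG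
  have hGpos : ∀ x ∈ U, 0 < G x := fun x hx => gram_det_pos_of_spacelike (hsp x hx)
  have hW : ∀ x ∈ U, inner ℝ (u x).1 (u x).1 * inner ℝ (v x).1 (v x).1 -
      inner ℝ (u x).1 (v x).1 ^ 2 ≠ 0 := by
    -- The spatial part of a space-like vector is nonzero, so the spatial parts of the two tangent
    -- vectors stay independent.
    intro x hx
    have hp : ∀ a b : ℝ, a ≠ 0 ∨ b ≠ 0 → 0 < a ^ 2 * inner ℝ (u x).1 (u x).1 +
        2 * a * b * inner ℝ (u x).1 (v x).1 + b ^ 2 * inner ℝ (v x).1 (v x).1 := by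
      intro a b hab
      have h1 := hsp x hx _ (single_comb_ne hab)
      simp only [map_add, map_smul, lor_add_left, lor_add_right, lor_smul_left, lor_smul_right]
        at h1
      change 0 < a * (a * lor (u x) (u x) + b * lor (v x) (u x)) +
        b * (a * lor (u x) (v x) + b * lor (v x) (v x)) at h1
      simp only [lor] at h1
      rw [real_inner_comm (u x).1 (v x).1] at h1
      nlinarith [sq_nonneg (a * (u x).2 + b * (v x).2)]
    have h0 := hp 1 0 (by norm_num)
    have h1 := hp (-inner ℝ (u x).1 (v x).1) (inner ℝ (u x).1 (u x).1)
      (Or.inr (by intro h; rw [h] at h0; norm_num at h0))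
    intro h
    have : (inner ℝ (u x).1 (u x).1 : ℝ) * (inner ℝ (u x).1 (u x).1 * inner ℝ (v x).1 (v x).1 -
      inner ℝ (u x).1 (v x).1 ^ 2) = 0 := by rw [h, mul_zero]
    linarith
  have hsmooth : ∀ e : E2 → ℝ, ContDiffOn ℝ ∞ e U →
      ContDiffOn ℝ ∞ (fun x => nullNormal (u x) (v x) (e x)) U := by
    intro e he
    have u1 := hus.fst
    have u2 := hus.snd
    have v1 := hvs.fst
    have v2 := hvs.snd
    have uu := u1.inner ℝ u1
    have uv := u1.inner ℝ v1
    have vv := v1.inner ℝ v1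
    exact (((uu.mul vv).sub (uv.pow 2)).inv hW).smul
      (((((v2.mul uv).sub (u2.mul vv)).smul u1).add (((u2.mul uv).sub (v2.mul uu)).smul v1)).add
        (he.smul (contDiffOn_cross u1 v1)))
  have hGs : ContDiffOn ℝ ∞ (fun x => √(G x)) U :=
    (((contDiffOn_lor hus hus).mul (contDiffOn_lor hvs hvs)).sub
      ((contDiffOn_lor hus hvs).pow 2)).sqrt fun x hx => (hGpos x hx).ne'
  have horth : ∀ e : E2 → ℝ, ∀ x ∈ U, ∀ w,
      lor (fderiv ℝ s x w) (-nullNormal (u x) (v x) (e x), 1) = 0 := by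
    intro e x hx w
    have hw : w = w 0 • EuclideanSpace.single (0 : Fin 2) (1 : ℝ) +
        w 1 • EuclideanSpace.single 1 1 := by
      ext i
      fin_cases i <;> simp
    rw [hw, map_add, map_smul, map_smul, lor_add_left, lor_smul_left, lor_smul_left]
    change w 0 * lor (u x) _ + w 1 * lor (v x) _ = 0
    rw [lor_neg_one, lor_neg_one, inner_nullNormal_left (hW x hx), inner_nullNormal_right (hW x hx)]
    ring
  refine ⟨fun x => nullNormal (u x) (v x) (√(G x)), fun x => nullNormal (u x) (v x) (-√(G x)),
    hsmooth _ hGs, hsmooth _ hGs.neg, fun x hx => ?_, fun x hx => ?_, fun x hx h => ?_,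
    horth _, horth _⟩
  · exact norm_nullNormal (hW x hx) (Real.sq_sqrt (hGpos x hx).le)
  · exact norm_nullNormal (hW x hx) (by rw [neg_sq]; exact Real.sq_sqrt (hGpos x hx).le)
  · have h1 := congrArg (fun n => inner ℝ (cross (u x).1 (v x).1) n) h
    simp only [inner_cross_nullNormal (hW x hx)] at h1
    have h2 := Real.sqrt_pos.mpr (hGpos x hx)
    linarith

/-! ### Envelopes in coordinates -/

section CoordinateEnvelope

variable {U : Set E2} {s : E2 → Mink} {f n : E2 → E3} {x : E2}

theorem fderiv_neg_one (hU : IsOpen U) (hn : ContDiffOn ℝ ∞ n U) (hx : x ∈ U) (v : E2) :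
    fderiv ℝ (fun y => ((-n y, 1) : Mink)) x v = (-fderiv ℝ n x v, 0) := by
  have h1 := differentiableAt_of_contDiffOn hU hn hx
  have h2 := (h1.hasFDerivAt.neg.prodMk (hasFDerivAt_const (1 : ℝ) x)).fderiv
  rw [show (fun y => ((-n y, 1) : Mink)) = fun y => ((-n) y, (1 : ℝ)) from rfl, h2]
  rfl

theorem inner_fderiv_unit (hU : IsOpen U) (hn : ContDiffOn ℝ ∞ n U)
    (hunit : ∀ y ∈ U, ‖n y‖ = 1) (hx : x ∈ U) (v : E2) :
    inner ℝ (fderiv ℝ n x v) (n x) = 0 := by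
  have h1 := differentiableAt_of_contDiffOn hU hn hx
  have h2 : (fun y => (inner ℝ (n y) (n y) : ℝ)) =ᶠ[𝓝 x] fun _ => 1 :=
    Filter.eventuallyEq_of_mem (hU.mem_nhds hx) fun y hy => by
      rw [real_inner_self_eq_norm_sq, hunit y hy]; norm_num
  have h3 := fderiv_inner_apply ℝ h1 h1 v
  rw [h2.fderiv_eq, real_inner_comm (fderiv ℝ n x v)] at h3
  simp at h3
  linarith

theorem fderiv_envelope (hU : IsOpen U) (hs : ContDiffOn ℝ ∞ s U) (hn : ContDiffOn ℝ ∞ n U)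
    (hf : ∀ y ∈ U, f y = (s y).1 + (s y).2 • n y) (hx : x ∈ U) (v : E2) :
    fderiv ℝ f x v = (fderiv ℝ s x v).1 + (fderiv ℝ s x v).2 • n x +
      (s x).2 • fderiv ℝ n x v := by
  have hn' := (differentiableAt_of_contDiffOn hU hn hx).hasFDerivAt
  have hs' := (differentiableAt_of_contDiffOn hU hs hx).hasFDerivAt
  have h2 : f =ᶠ[𝓝 x] fun y => (s y).1 + (s y).2 • n y :=
    Filter.eventuallyEq_of_mem (hU.mem_nhds hx) hf
  rw [h2.fderiv_eq, (hs'.fst.fun_add (hs'.snd.fun_smul hn')).fderiv]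
  simp only [add_apply, smul_apply, ContinuousLinearMap.smulRight_apply,
    ContinuousLinearMap.comp_apply, ContinuousLinearMap.coe_fst', ContinuousLinearMap.coe_snd']
  abel

/-- Since `n · dn = 0`, the contact condition `df · n = 0` is the same as normality of `(-n, 1)` to
the surface of spheres. -/
theorem lor_fderiv_eq_neg_inner (hU : IsOpen U) (hs : ContDiffOn ℝ ∞ s U)
    (hn : ContDiffOn ℝ ∞ n U) (hunit : ∀ y ∈ U, ‖n y‖ = 1)
    (hf : ∀ y ∈ U, f y = (s y).1 + (s y).2 • n y) (hx : x ∈ U) (v : E2) :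
    lor (fderiv ℝ s x v) (-n x, 1) = -inner ℝ (fderiv ℝ f x v) (n x) := by
  rw [lor_neg_one, fderiv_envelope hU hs hn hf hx, inner_add_left, inner_add_left,
    inner_smul_left, inner_smul_left, inner_fderiv_unit hU hn hunit hx,
    real_inner_self_eq_norm_sq, hunit x hx]
  simp
  ring

/-- The second fundamental form of an envelope is that of the null normal, shifted by the radius
times the third. -/
theorem neg_inner_fderiv_envelope (hU : IsOpen U) (hs : ContDiffOn ℝ ∞ s U)
    (hn : ContDiffOn ℝ ∞ n U) (hunit : ∀ y ∈ U, ‖n y‖ = 1)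
    (hf : ∀ y ∈ U, f y = (s y).1 + (s y).2 • n y) (hx : x ∈ U) (v w : E2) :
    -inner ℝ (fderiv ℝ f x v) (fderiv ℝ n x w) =
      lor (fderiv ℝ s x v) (fderiv ℝ (fun y => ((-n y, 1) : Mink)) x w) -
        (s x).2 * inner ℝ (fderiv ℝ n x v) (fderiv ℝ n x w) := by
  rw [fderiv_neg_one hU hn hx, fderiv_envelope hU hs hn hf hx, inner_add_left, inner_add_left,
    inner_smul_left, inner_smul_left, real_inner_comm (fderiv ℝ n x w) (n x),
    inner_fderiv_unit hU hn hunit hx]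
  simp [lor]
  ring

end CoordinateEnvelope

/-! ### Passage to a chart -/

section Chart

variable {M : Type*} [TopologicalSpace M] [ChartedSpace E2 M]
variable {W : Type*} [NormedAddCommGroup W] [NormedSpace ℝ W]

/-- The part of the chart at `p` that lies over the set `V`. -/
def chartDomain (p : M) (V : Set M) : Set E2 :=
  (extChartAt (𝓡 2) p).target ∩ (extChartAt (𝓡 2) p).symm ⁻¹' V

theorem isOpen_chartDomain (p : M) {V : Set M} (hV : IsOpen V) : IsOpen (chartDomain p V) :=
  (continuousOn_extChartAt_symm p).isOpen_inter_preimage (isOpen_extChartAt_target p) hV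

theorem mem_chartDomain {p q : M} {V : Set M} (hq : q ∈ (extChartAt (𝓡 2) p).source)
    (hqV : q ∈ V) : extChartAt (𝓡 2) p q ∈ chartDomain p V :=
  ⟨(extChartAt (𝓡 2) p).map_source hq, by
    rw [Set.mem_preimage, (extChartAt (𝓡 2) p).left_inv hq]; exact hqV⟩

theorem mdifferentiableAt_of_contMDiffOn {V : Set M} (hV : IsOpen V) {F : M → W}
    (hF : ContMDiffOn (𝓡 2) 𝓘(ℝ, W) ∞ F V) {q : M} (hq : q ∈ V) :
    MDifferentiableAt (𝓡 2) 𝓘(ℝ, W) F q :=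
  (hF.contMDiffAt (hV.mem_nhds hq)).mdifferentiableAt (by simp)

/-- The tangent space at `q` is modelled on `E2` through the preferred chart at `q`, so at the
center of that chart no transition map intervenes. -/
theorem fderiv_chart_center {F : M → W} {q : M} (hF : MDifferentiableAt (𝓡 2) 𝓘(ℝ, W) F q)
    (v : E2) : fderiv ℝ (F ∘ (extChartAt (𝓡 2) q).symm) (extChartAt (𝓡 2) q q) v = dMap F q v := by
  change _ = mfderiv (𝓡 2) 𝓘(ℝ, W) F q v
  rw [hF.mfderiv]
  simp only [writtenInExtChartAt, extChartAt_model_space_eq_id, modelWithCornersSelf_coe,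
    Set.range_id, fderivWithin_univ, PartialEquiv.refl_coe, Function.id_comp]
  rfl

variable [IsManifold (𝓡 2) ∞ M]

theorem contDiffOn_chart (p : M) {V : Set M} {F : M → W}
    (hF : ContMDiffOn (𝓡 2) 𝓘(ℝ, W) ∞ F V) :
    ContDiffOn ℝ ∞ (F ∘ (extChartAt (𝓡 2) p).symm) (chartDomain p V) := by
  rw [← contMDiffOn_iff_contDiffOn]
  exact hF.comp ((contMDiffOn_extChartAt_symm p).mono Set.inter_subset_left)
    fun x hx => hx.2

/-- The differential of the inverse of the chart at `p`. -/
def chartJ (p : M) (x : E2) : E2 →L[ℝ] E2 :=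
  mfderiv 𝓘(ℝ, E2) (𝓡 2) (extChartAt (𝓡 2) p).symm x

theorem mdifferentiableAt_chart_symm (p : M) {x : E2} (hx : x ∈ (extChartAt (𝓡 2) p).target) :
    MDifferentiableAt 𝓘(ℝ, E2) (𝓡 2) (extChartAt (𝓡 2) p).symm x :=
  ((contMDiffOn_extChartAt_symm (n := ∞) p).contMDiffAt
    ((isOpen_extChartAt_target p).mem_nhds hx)).mdifferentiableAt (by simp)

theorem fderiv_chart (p : M) {x : E2} (hx : x ∈ (extChartAt (𝓡 2) p).target) {F : M → W}
    (hF : MDifferentiableAt (𝓡 2) 𝓘(ℝ, W) F ((extChartAt (𝓡 2) p).symm x)) (v : E2) :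
    fderiv ℝ (F ∘ (extChartAt (𝓡 2) p).symm) x v =
      dMap F ((extChartAt (𝓡 2) p).symm x) (chartJ p x v) := by
  rw [← mfderiv_eq_fderiv, mfderiv_comp x hF (mdifferentiableAt_chart_symm p hx)]
  rfl

theorem chartJ_injective (p : M) {x : E2} (hx : x ∈ (extChartAt (𝓡 2) p).target) :
    Function.Injective (chartJ p x) := by
  have hsrc : (extChartAt (𝓡 2) p).symm x ∈ (extChartAt (𝓡 2) p).source :=
    (extChartAt (𝓡 2) p).map_target hx
  have hφ : MDifferentiableAt (𝓡 2) 𝓘(ℝ, E2) (extChartAt (𝓡 2) p)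
      ((extChartAt (𝓡 2) p).symm x) :=
    (contMDiffAt_extChartAt' (n := ∞) (by simpa using hsrc)).mdifferentiableAt (by simp)
  have h1 : ((extChartAt (𝓡 2) p) ∘ (extChartAt (𝓡 2) p).symm : E2 → E2) =ᶠ[𝓝 x] id :=
    Filter.eventuallyEq_of_mem ((isOpen_extChartAt_target p).mem_nhds hx) fun y hy =>
      (extChartAt (𝓡 2) p).right_inv hy
  intro v w hvw
  have hv := fderiv_chart p hx hφ v
  have hw := fderiv_chart p hx hφ w
  rw [h1.fderiv_eq, fderiv_id] at hv hw
  change v = _ at hv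
  change w = _ at hw
  rw [hv, hw, hvw]

theorem chartJ_surjective (p : M) {x : E2} (hx : x ∈ (extChartAt (𝓡 2) p).target) :
    Function.Surjective (chartJ p x) :=
  LinearMap.injective_iff_surjective.mp (chartJ_injective p hx : Function.Injective
    (chartJ p x : E2 →ₗ[ℝ] E2))

end Chart

/-! ### Shape operators of a pair of envelopes -/

section Manifold

variable {M : Type*} [TopologicalSpace M] [ChartedSpace E2 M]
variable {S : M → Mink} {V : Set M} {f n f' n' : M → E3}

theorem mem_contactLine_iff {u : Mink} {x n : E3} :
    u ∈ contactLine x n ↔ x = u.1 + u.2 • n := by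
  constructor
  · rintro ⟨t, rfl⟩
    exact (sub_add_cancel x (t • n)).symm
  · intro h
    exact ⟨u.2, Prod.ext (by rw [h]; simp) rfl⟩

/-- Recentering the contact line at a given sphere shows that isometries need only be checked on
that sphere and on the direction `(-n, 1)`. -/
theorem contactLine_eq {u : Mink} {x n : E3} (h : u ∈ contactLine x n) :
    contactLine x n = {w | ∃ t : ℝ, w = u + t • ((-n, 1) : Mink)} := by
  obtain ⟨r, rfl⟩ := h
  ext w
  constructor
  · rintro ⟨t, rfl⟩
    refine ⟨t - r, Prod.ext ?_ ?_⟩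
    · simp [sub_smul]
      abel
    · simp
  · rintro ⟨t, rfl⟩
    refine ⟨r + t, Prod.ext ?_ ?_⟩
    · simp [add_smul]
      abel
    · simp

theorem IsEnvelopePair.mono (h : IsEnvelopePair V S f n f' n') {V' : Set M} (hV' : IsOpen V')
    (hsub : V' ⊆ V) : IsEnvelopePair V' S f n f' n' := by
  have hmono : ∀ {f n : M → E3}, Envelopes V S f n → Envelopes V' S f n := fun h =>
    ⟨{ smooth_f := h.1.smooth_f.mono hsub
       smooth_n := h.1.smooth_n.mono hsub
       unit := fun q hq => h.1.unit q (hsub hq)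
       contact := fun q hq => h.1.contact q (hsub hq)
       immersion := fun q hq => h.1.immersion q (hsub hq) }, fun q hq => h.2 q (hsub hq)⟩
  exact ⟨hV', hmono h.fst, hmono h.snd, fun q hq => h.distinct q (hsub hq)⟩

theorem IsEnvelopePair.normal_ne (h : IsEnvelopePair V S f n f' n') {q : M} (hq : q ∈ V) :
    n q ≠ n' q := by
  intro hn
  have h1 := mem_contactLine_iff.mp (h.fst.2 q hq)
  have h2 := mem_contactLine_iff.mp (h.snd.2 q hq)
  exact h.distinct q hq (Prod.ext (by rw [h1, h2, hn]) hn)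

/-- The null normal field of an envelope, in the chart at `p`. -/
def chartNull (n : M → E3) (p : M) (x : E2) : Mink := (-n ((extChartAt (𝓡 2) p).symm x), 1)

theorem Envelopes.chart_eq (h : Envelopes V S f n) (p : M) :
    ∀ y ∈ chartDomain p V, (f ∘ (extChartAt (𝓡 2) p).symm) y =
      (localRep S p y).1 + (localRep S p y).2 • (n ∘ (extChartAt (𝓡 2) p).symm) y :=
  fun _ hy => mem_contactLine_iff.mp (h.2 _ hy.2)

/-- `A` is the shape operator of the envelope `(f, n)` of `S` at `q`, for the
induced scalar product `g`. -/
structure IsShapeOperator (S : M → Mink) (f n : M → E3) (q : M) (g : E2 →ₗ[ℝ] E2 →ₗ[ℝ] ℝ)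
    (A : E2 →ₗ[ℝ] E2) : Prop where
  metric : ∀ v w : E2, g v w = lor (dMap S q v) (dMap S q w)
  scalarProduct : IsScalarProduct g
  symm : ∀ v w, g (A v) w = g (A w) v
  third : ∀ v w : E2, thirdForm n q v w = g (A v) (A w)
  second : ∀ v w : E2, secondForm f n q v w = g (A w) v - (S q).2 * g (A v) (A w)
  lor_dn : ∀ v w : E2, lor (dMap S q v) (-dMap n q w, 0) = g (A w) v

namespace IsShapeOperator

variable {q : M} {g : E2 →ₗ[ℝ] E2 →ₗ[ℝ] ℝ} {A : E2 →ₗ[ℝ] E2}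

theorem injective (h : IsShapeOperator S f n q g A) (hn : ThirdFormPosDef n q) :
    Function.Injective A := by
  rw [← LinearMap.ker_eq_bot, LinearMap.ker_eq_bot']
  intro v hv
  by_contra hne
  have h1 := hn v hne
  rw [h.third, hv] at h1
  simp at h1

/-- With `r` the radius, `II = h III` on `v` reads `A v = (h + r) A (A v)`. Cancelling the injective
`A` leaves `v = (h + r) A v`, so `k = 1 / (h + r)`. -/
theorem isCurvatureDirection_iff (h : IsShapeOperator S f n q g A) (hinj : Function.Injective A)
    {v : E2} : IsCurvatureDirection f n q v ↔ v ≠ 0 ∧ ∃ k : ℝ, k ≠ 0 ∧ A v = k • v := by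
  refine and_congr_right fun hv => ⟨?_, ?_⟩
  · rintro ⟨c, hc⟩
    have h1 : v = (c + (S q).2) • A v := by
      refine hinj (h.scalarProduct.eq_of_forall fun w => ?_)
      have h2 := hc w
      rw [h.second, h.third, h.symm w v, h.scalarProduct.symm (A v) (A w),
        h.symm w (A v)] at h2
      rw [map_smul, map_smul, LinearMap.smul_apply, smul_eq_mul]
      linarith
    have h3 : c + (S q).2 ≠ 0 := by
      intro h0
      rw [h0, zero_smul] at h1
      exact hv h1
    refine ⟨(c + (S q).2)⁻¹, inv_ne_zero h3, ?_⟩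
    conv_rhs => rw [h1]
    rw [smul_smul, inv_mul_cancel₀ h3, one_smul]
  · rintro ⟨k, hk, hAv⟩
    refine ⟨k⁻¹ - (S q).2, fun w => ?_⟩
    refine (h.second v w).trans (Eq.trans ?_ (congrArg _ (h.third v w).symm))
    rw [hAv, map_smul, LinearMap.smul_apply, smul_eq_mul, h.scalarProduct.symm v (A w)]
    field_simp

/-- The sign comes from the spatial part `-n` of the null normal. -/
theorem isGaussDifferential_iff (h : IsShapeOperator S f n q g A)
    {B : E2 →ₗ[ℝ] E2} : IsGaussDifferential S n q B ↔ B = -A := by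
  have key : ∀ v w : E2, lor ((dMap n q v, 0) - dMap S q (B v)) (dMap S q w) =
      g ((-A) v) w - g (B v) w := by
    intro v w
    have h1 := h.lor_dn w v
    have h2 : ((-dMap n q v, 0) : Mink) = -(dMap n q v, 0) := by simp
    rw [h2, lor_neg_right, lor_comm] at h1
    rw [lor_sub_left, ← h.metric, LinearMap.neg_apply, map_neg, LinearMap.neg_apply, ← h1, neg_neg]
  constructor
  · intro hB
    refine LinearMap.ext fun v => h.scalarProduct.eq_of_forall fun w => ?_
    have := (key v w).symm.trans (hB v w)
    linarith
  · rintro hB v w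
    exact (key v w).trans (by rw [hB, sub_self])

end IsShapeOperator

variable [IsManifold (𝓡 2) ∞ M]

theorem contDiffOn_localRep (hS : ContMDiff (𝓡 2) 𝓘(ℝ, Mink) ∞ S) (p : M) (V : Set M) :
    ContDiffOn ℝ ∞ (localRep S p) (chartDomain p V) :=
  contDiffOn_chart p hS.contMDiffOn

theorem fderiv_localRep (hS : ContMDiff (𝓡 2) 𝓘(ℝ, Mink) ∞ S) (p : M) {x : E2}
    (hx : x ∈ (extChartAt (𝓡 2) p).target) (v : E2) :
    fderiv ℝ (localRep S p) x v = dMap S ((extChartAt (𝓡 2) p).symm x) (chartJ p x v) :=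
  fderiv_chart p hx (hS.mdifferentiable (by simp) _) v

theorem spacelike_localRep (hS : IsSpacelikeImmersion S) (p : M) {x : E2}
    (hx : x ∈ (extChartAt (𝓡 2) p).target) {v : E2} (hv : v ≠ 0) :
    0 < lor (fderiv ℝ (localRep S p) x v) (fderiv ℝ (localRep S p) x v) := by
  rw [fderiv_localRep hS.smooth p hx]
  refine hS.spacelike _ _ fun h0 => hv (chartJ_injective p hx ?_)
  rw [map_zero]
  exact h0

theorem Envelopes.chart_orth (hS : IsSpacelikeImmersion S) (hV : IsOpen V)
    (h : Envelopes V S f n) (p : M) {x : E2} (hx : x ∈ chartDomain p V) (v : E2) :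
    lor (fderiv ℝ (localRep S p) x v) (chartNull n p x) = 0 := by
  have h1 := lor_fderiv_eq_neg_inner (isOpen_chartDomain p hV) (contDiffOn_localRep hS.smooth p V)
    (contDiffOn_chart p h.1.smooth_n) (fun y hy => h.1.unit _ hy.2) (h.chart_eq p) hx v
  refine h1.trans ?_
  rw [fderiv_chart p hx.1 (mdifferentiableAt_of_contMDiffOn hV h.1.smooth_f hx.2)]
  rw [neg_eq_zero]
  exact h.1.contact _ hx.2 _

theorem IsEnvelopePair.hasNullNormals (hS : IsSpacelikeImmersion S)
    (h : IsEnvelopePair V S f n f' n') (p : M) :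
    HasNullNormals (chartDomain p V) (localRep S p) (chartNull n p) (chartNull n' p) :=
  hasNullNormals_of_unit (isOpen_chartDomain p h.isOpen) (contDiffOn_localRep hS.smooth p V)
    (fun _ hx _ hv => spacelike_localRep hS p hx.1 hv)
    (contDiffOn_chart p h.fst.1.smooth_n) (contDiffOn_chart p h.snd.1.smooth_n)
    (fun _ hx => h.fst.1.unit _ hx.2) (fun _ hx => h.snd.1.unit _ hx.2)
    (fun _ hx => h.normal_ne hx.2)
    (fun _ hx v => h.fst.chart_orth hS h.isOpen p hx v)
    (fun _ hx v => h.snd.chart_orth hS h.isOpen p hx v)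

theorem Envelopes.isShapeOperator (hS : IsSpacelikeImmersion S) (hV : IsOpen V)
    (henv : Envelopes V S f n) {q : M} (hq : q ∈ V) {N' : E2 → Mink}
    (h : HasNullNormals (chartDomain q V) (localRep S q) (chartNull n q) N')
    {A : E2 →ₗ[ℝ] E2}
    (hA : ∀ v w, pullback (fderiv ℝ (localRep S q) (extChartAt (𝓡 2) q q)) (A v) w =
      pullback (fderiv ℝ (localRep S q) (extChartAt (𝓡 2) q q)) (A w) v)
    (hN : ∀ v w, lor (fderiv ℝ (localRep S q) (extChartAt (𝓡 2) q q) v)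
      (fderiv ℝ (chartNull n q) (extChartAt (𝓡 2) q q) w) =
        pullback (fderiv ℝ (localRep S q) (extChartAt (𝓡 2) q q)) (A w) v)
    (hdN : ∀ v, ∃ c : ℝ, fderiv ℝ (chartNull n q) (extChartAt (𝓡 2) q q) v =
      fderiv ℝ (localRep S q) (extChartAt (𝓡 2) q q) (A v) +
        c • chartNull n q (extChartAt (𝓡 2) q q)) :
    IsShapeOperator S f n q (pullback (fderiv ℝ (localRep S q) (extChartAt (𝓡 2) q q))) A := by
  set x := extChartAt (𝓡 2) q q with hxdef
  have hx : x ∈ chartDomain q V := mem_chartDomain (mem_extChartAt_source q) hq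
  have hU := isOpen_chartDomain q hV
  have hs := contDiffOn_localRep hS.smooth q V
  have hn := contDiffOn_chart q henv.1.smooth_n
  have hunit : ∀ y ∈ chartDomain q V, ‖(n ∘ (extChartAt (𝓡 2) q).symm) y‖ = 1 :=
    fun y hy => henv.1.unit _ hy.2
  have dS : ∀ v : E2, fderiv ℝ (localRep S q) x v = dMap S q v := fun v =>
    fderiv_chart_center (hS.smooth.mdifferentiable (by simp) _) v
  have dn : ∀ v : E2, fderiv ℝ (n ∘ (extChartAt (𝓡 2) q).symm) x v = dMap n q v := fun v =>
    fderiv_chart_center (mdifferentiableAt_of_contMDiffOn hV henv.1.smooth_n hq) v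
  have df : ∀ v : E2, fderiv ℝ (f ∘ (extChartAt (𝓡 2) q).symm) x v = dMap f q v := fun v =>
    fderiv_chart_center (mdifferentiableAt_of_contMDiffOn hV henv.1.smooth_f hq) v
  have dN : ∀ v : E2, fderiv ℝ (chartNull n q) x v = (-dMap n q v, 0) := fun v => by
    rw [← dn]
    exact fderiv_neg_one hU hn hx v
  -- The constant time component of `N` gives `dn · dn = ⟨dN, dN⟩`, and the `N` component of `dN` is
  -- null and orthogonal to the tangential part.
  have hthird : ∀ v w : E2, thirdForm n q v w = pullback (fderiv ℝ (localRep S q) x) (A v) (A w) := by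
    intro v w
    have h1 : thirdForm n q v w = lor (fderiv ℝ (chartNull n q) x v)
        (fderiv ℝ (chartNull n q) x w) := by
      rw [dN, dN]
      simp [lor, thirdForm]
    obtain ⟨c, hc⟩ := hdN v
    obtain ⟨d, hd⟩ := hdN w
    rw [h1, hc, hd]
    simp only [lor_add_left, lor_add_right, lor_smul_left, lor_smul_right, h.orth x hx,
      lor_comm (chartNull n q x) (fderiv ℝ (localRep S q) x _), h.null x hx]
    simp
  refine ⟨fun v w => ?_, h.isScalarProduct hx, hA, hthird, fun v w => ?_, fun v w => ?_⟩
  · rw [pullback_apply, dS, dS]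
  · have h1 := neg_inner_fderiv_envelope hU hs hn hunit (henv.chart_eq q) hx v w
    rw [df, dn, dn] at h1
    have h2 : (localRep S q x).2 = (S q).2 := by
      rw [localRep, hxdef, extChartAt_to_inv]
    have h3 := hN v w
    rw [← hthird, ← h3, ← h2]
    exact h1
  · rw [← hN, dN, dS]

/-- The shape operators at `q` of a pair of envelopes determine the curvature of the
induced metric and of the normal bundle. -/
theorem IsEnvelopePair.exists_shapeOperators (hS : IsSpacelikeImmersion S)
    (h : IsEnvelopePair V S f n f' n') {q : M} (hq : q ∈ V) :
    ∃ (g : E2 →ₗ[ℝ] E2 →ₗ[ℝ] ℝ) (A A' : E2 →ₗ[ℝ] E2), IsShapeOperator S f n q g A ∧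
      IsShapeOperator S f' n' q g A' ∧
      ((∀ l k i j, riemannTensor (gram (localRep S q)) l k i j (extChartAt (𝓡 2) q q) = 0) ↔
        ∀ v w, mixedDisc g A A' v w = 0) ∧
      ((∀ ξ : E2 → Mink, IsNormalFieldNear (localRep S q) (extChartAt (𝓡 2) q q) ξ →
        ∀ i j : Fin 2,
        normalD (localRep S q) i (normalD (localRep S q) j ξ) (extChartAt (𝓡 2) q q) =
        normalD (localRep S q) j (normalD (localRep S q) i ξ) (extChartAt (𝓡 2) q q)) ↔
        ∀ v, A (A' v) = A' (A v)) := by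
  have hx : extChartAt (𝓡 2) q q ∈ chartDomain q V := mem_chartDomain (mem_extChartAt_source q) hq
  have hN := h.hasNullNormals hS q
  obtain ⟨A, hA, hAN, hdN⟩ := hN.exists_shape hx
  obtain ⟨A', hA', hAN', hdN'⟩ := hN.swap.exists_shape hx
  exact ⟨_, A, A', h.fst.isShapeOperator hS h.isOpen hq hN hA hAN fun v => ⟨_, hdN v⟩,
    h.snd.isShapeOperator hS h.isOpen hq hN.swap hA' hAN' fun v => ⟨_, hdN' v⟩,
    hN.flat_iff hx hA hA' hAN hAN', hN.normal_flat_iff hx hA hA' hAN hAN'⟩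

end Manifold

section Main

variable {M : Type*} [TopologicalSpace M] [ChartedSpace E2 M]
variable {S : M → Mink} {V : Set M} {f n f' n' : M → E3} {q : M}
  {g : E2 →ₗ[ℝ] E2 →ₗ[ℝ] ℝ} {A A' : E2 →ₗ[ℝ] E2}

theorem finrank_E2 : Module.finrank ℝ E2 = 2 := by simp

/-! ### Shape operators of Darboux congruences -/

theorem commute_of_darboux (h : IsShapeOperator S f n q g A) (h' : IsShapeOperator S f' n' q g A')
    (hpc : PreservesCurvatureDirections f n f' n' q) (hconf : ConformalThirdForms n n' q) :
    (∀ x, A (A' x) = A' (A x)) ∧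
      ((∃ l : ℝ, l ≠ 0 ∧ ∀ x, A' x = l • A x) ∨ ∀ x y, mixedDisc g A A' x y = 0) := by
  obtain ⟨hn, hn', c, hc, hcc⟩ := hconf
  obtain ⟨v, hv, hcurv⟩ := hpc
  have hinj := h.injective hn
  have hinj' := h'.injective hn'
  choose k _ hk using fun i => ((h.isCurvatureDirection_iff hinj).mp (hcurv i).1).2
  choose k' _ hk' using fun i => ((h'.isCurvatureDirection_iff hinj').mp (hcurv i).2).2
  refine commute_and_proportional_or_mixedDisc_eq_zero finrank_E2 h.scalarProduct h.symm h'.symm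
    hinj hc (fun v w => ?_) hv hk hk'
  exact (h'.third v w).symm.trans ((hcc v w).trans (congrArg _ (h.third v w)))

/-- The pointwise converse; the negative determinant product is what later excludes degeneracy. -/
theorem darboux_of_mixedDisc_eq_zero (h : IsShapeOperator S f n q g A)
    (h' : IsShapeOperator S f' n' q g A') (hn : ThirdFormPosDef n q) (hn' : ThirdFormPosDef n' q)
    (hcomm : ∀ x, A (A' x) = A' (A x)) (hmix : ∀ x y, mixedDisc g A A' x y = 0) :
    PreservesCurvatureDirections f n f' n' q ∧ ConformalThirdForms n n' q ∧
      LinearMap.det A * LinearMap.det A' < 0 := by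
  have hinj := h.injective hn
  have hinj' := h'.injective hn'
  obtain ⟨⟨v, hv, hk, hk'⟩, ⟨c, hc, hcc⟩, hdet⟩ :=
    eigenbasis_of_commute_of_mixedDisc_eq_zero finrank_E2 h.scalarProduct h.symm h'.symm hinj hinj'
      hcomm hmix
  refine ⟨⟨v, hv, fun i => ⟨?_, ?_⟩⟩, ⟨hn, hn', c, hc, fun v w => ?_⟩, hdet⟩
  · exact (h.isCurvatureDirection_iff hinj).mpr ⟨hv.ne_zero i, hk i⟩
  · exact (h'.isCurvatureDirection_iff hinj').mpr ⟨hv.ne_zero i, hk' i⟩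
  · exact (h'.third v w).trans ((hcc v w).trans (congrArg _ (h.third v w).symm))

theorem det_neg_mul_det_neg (A A' : E2 →ₗ[ℝ] E2) :
    LinearMap.det (-A) * LinearMap.det (-A') = LinearMap.det A * LinearMap.det A' := by
  have h : ∀ B : E2 →ₗ[ℝ] E2, LinearMap.det (-B) = LinearMap.det B := by
    intro B
    rw [← neg_one_smul ℝ B, LinearMap.det_smul, finrank_E2]
    norm_num
  rw [h, h]

theorem sameOrientationAt_iff (h : IsShapeOperator S f n q g A)
    (h' : IsShapeOperator S f' n' q g A') :
    SameOrientationAt S n n' q ↔ 0 < LinearMap.det A * LinearMap.det A' := by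
  constructor
  · rintro ⟨B, B', hB, hB', hpos⟩
    have e := h.isGaussDifferential_iff.mp hB
    have e' := h'.isGaussDifferential_iff.mp hB'
    subst e e'
    exact (det_neg_mul_det_neg A A').symm ▸ hpos
  · intro hpos
    exact ⟨-A, -A', h.isGaussDifferential_iff.mpr rfl, h'.isGaussDifferential_iff.mpr rfl,
      lt_of_lt_of_eq hpos (det_neg_mul_det_neg A A').symm⟩

/-- In dimension two, scaling by `l` multiplies the determinant by `l ^ 2`, so proportional
operators induce the same orientation whatever the sign of `l`. -/
theorem det_mul_det_pos (hinj : Function.Injective A) {l : ℝ} (hl : l ≠ 0)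
    (hA : ∀ x, A' x = l • A x) : 0 < LinearMap.det A * LinearMap.det A' := by
  have h1 : A' = l • A := LinearMap.ext hA
  have h2 : LinearMap.det A ≠ 0 :=
    (LinearMap.isUnit_det A ((Module.End.isUnit_iff A).mpr
      ⟨hinj, LinearMap.injective_iff_surjective.mp hinj⟩)).ne_zero
  rw [h1, LinearMap.det_smul, finrank_E2]
  have : LinearMap.det A * (l ^ 2 * LinearMap.det A) = (l * LinearMap.det A) ^ 2 := by ring
  rw [this]
  positivity

variable [IsManifold (𝓡 2) ∞ M]

/-! ### Local existence of envelopes -/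

theorem exists_envelopePair (hS : IsSpacelikeImmersion S) (p : M) :
    ∃ (V : Set M) (f n f' n' : M → E3), p ∈ V ∧ IsEnvelopePair V S f n f' n' := by
  set φ := extChartAt (𝓡 2) p with hφ
  have hU := isOpen_extChartAt_target (I := 𝓡 2) p
  have hdom : chartDomain p φ.source = φ.target :=
    Set.inter_eq_left.mpr fun x hx => φ.map_target hx
  have hs : ContDiffOn ℝ ∞ (localRep S p) φ.target := hdom ▸ contDiffOn_localRep hS.smooth p _
  have hV : IsOpen φ.source := isOpen_extChartAt_source p
  obtain ⟨n, n', hn, hn', hu, hu', hne, ho, ho'⟩ :=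
    exists_null_normals hU hs fun x hx v hv => spacelike_localRep hS p hx hv
  have key : ∀ n : E2 → E3, ContDiffOn ℝ ∞ n φ.target → (∀ x ∈ φ.target, ‖n x‖ = 1) →
      (∀ x ∈ φ.target, ∀ v, lor (fderiv ℝ (localRep S p) x v) (-n x, 1) = 0) →
      Envelopes φ.source S (fun q => (S q).1 + (S q).2 • n (φ q)) (fun q => n (φ q)) := by
    intro n hn hu ho
    have hφs : ContMDiffOn (𝓡 2) 𝓘(ℝ, E2) ∞ φ φ.source := by
      rw [hφ, extChartAt_source]
      exact contMDiffOn_extChartAt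
    have hnM : ContMDiffOn (𝓡 2) 𝓘(ℝ, E3) ∞ (fun q => n (φ q)) φ.source :=
      hn.contMDiffOn.comp hφs fun q hq => φ.map_source hq
    have hS1 : ContMDiff (𝓡 2) 𝓘(ℝ, E3) ∞ fun q => (S q).1 :=
      (ContinuousLinearMap.fst ℝ E3 ℝ).contDiff.contMDiff.comp hS.smooth
    have hS2 : ContMDiff (𝓡 2) 𝓘(ℝ, ℝ) ∞ fun q => (S q).2 :=
      (ContinuousLinearMap.snd ℝ E3 ℝ).contDiff.contMDiff.comp hS.smooth
    have hfM : ContMDiffOn (𝓡 2) 𝓘(ℝ, E3) ∞ (fun q => (S q).1 + (S q).2 • n (φ q)) φ.source :=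
      hS1.contMDiffOn.add (hS2.contMDiffOn.smul hnM)
    have hf : ∀ y ∈ φ.target, ((fun q => (S q).1 + (S q).2 • n (φ q)) ∘ φ.symm) y =
        (localRep S p y).1 + (localRep S p y).2 • n y := by
      intro y hy
      simp only [Function.comp_apply, φ.right_inv hy]
      rfl
    have hnchart : ∀ y ∈ φ.target, ((fun q => n (φ q)) ∘ φ.symm) y = n y := fun y hy => by
      simp only [Function.comp_apply, φ.right_inv hy]
    have pull : ∀ q ∈ φ.source, ∀ v : E2, ∃ w : E2, (v ≠ 0 → w ≠ 0) ∧
        dMap (fun q => (S q).1 + (S q).2 • n (φ q)) q v =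
          fderiv ℝ ((fun q => (S q).1 + (S q).2 • n (φ q)) ∘ φ.symm) (φ q) w ∧
        dMap (fun q => n (φ q)) q v = fderiv ℝ n (φ q) w := by
      intro q hq v
      have hx := φ.map_source hq
      obtain ⟨w, hw⟩ := chartJ_surjective p hx v
      have hnn : ((fun q => n (φ q)) ∘ φ.symm) =ᶠ[𝓝 (φ q)] n :=
        Filter.eventuallyEq_of_mem (hU.mem_nhds hx) hnchart
      refine ⟨w, fun hv h0 => hv ?_, ?_, ?_⟩
      · rw [← hw, h0, map_zero]
      · have h1 := fderiv_chart p hx (F := fun q => (S q).1 + (S q).2 • n (φ q))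
          (mdifferentiableAt_of_contMDiffOn hV hfM (φ.map_target hx)) w
        rw [hw, φ.left_inv hq] at h1
        exact h1.symm
      · have h1 := fderiv_chart p hx (F := fun q => n (φ q))
          (mdifferentiableAt_of_contMDiffOn hV hnM (φ.map_target hx)) w
        rw [hw, φ.left_inv hq, hnn.fderiv_eq] at h1
        exact h1.symm
    refine ⟨⟨hfM, hnM, fun q hq => hu _ (φ.map_source hq), fun q hq v => ?_, fun q hq v hv => ?_⟩,
      fun q hq => mem_contactLine_iff.mpr rfl⟩
    · obtain ⟨w, -, h1, -⟩ := pull q hq v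
      have h2 := lor_fderiv_eq_neg_inner hU hs hn hu hf (φ.map_source hq) w
      rw [ho _ (φ.map_source hq)] at h2
      rw [h1]
      linarith
    · obtain ⟨w, hw, h1, h2⟩ := pull q hq v
      rw [h1, h2]
      -- If `df` and `dn` both vanished on a vector, `ds` would send it into the null direction
      -- `(-n, 1)`, against space-likeness.
      by_contra! hcon
      have hx := φ.map_source hq
      have h3 := fderiv_envelope hU hs hn hf hx w
      rw [hcon.1, hcon.2, smul_zero, add_zero] at h3
      have h4 := spacelike_localRep hS p hx (hw hv)
      have h5 : (fderiv ℝ (localRep S p) (φ q) w).1 =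
          -((fderiv ℝ (localRep S p) (φ q) w).2 • n (φ q)) := eq_neg_of_add_eq_zero_left h3.symm
      rw [lor, h5, inner_neg_neg, inner_smul_left, inner_smul_right, real_inner_self_eq_norm_sq,
        hu _ hx] at h4
      simp at h4
  refine ⟨φ.source, _, _, _, _, mem_extChartAt_source p, hV, key n hn hu ho, key n' hn' hu' ho', ?_⟩
  intro q hq heq
  exact hne _ (φ.map_source hq) (congrArg Prod.snd heq)

/-! ### Points of nonzero curvature of a Darboux congruence -/

/-- A nonzero mixed discriminant persists nearby, where the Darboux alternative leaves only
proportional shape operators; these yield the reflection carrying one envelope to the other. -/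
theorem degenerateSomewhere_of_mixedDisc_ne_zero (hS : IsSpacelikeImmersion S)
    (h : IsEnvelopePair V S f n f' n')
    (hD : ∀ q ∈ V, PreservesCurvatureDirections f n f' n' q ∧ ConformalThirdForms n n' q)
    {p : M} (hp : p ∈ V) {A A' : E2 →ₗ[ℝ] E2} (hA : IsShapeOperator S f n p g A)
    (hA' : IsShapeOperator S f' n' p g A') {v w : E2} (hm : mixedDisc g A A' v w ≠ 0) :
    DegenerateSomewhere S := by
  set φ := extChartAt (𝓡 2) p with hφ
  have hN := h.hasNullNormals hS p
  set s := localRep S p with hs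
  set N := chartNull n p with hNdef
  set N' := chartNull n' p with hNdef'
  set U := chartDomain p V with hUdef
  have hx₀ : φ p ∈ U := mem_chartDomain (mem_extChartAt_source p) hp
  have hpair : ∀ n : M → E3, ContMDiffOn (𝓡 2) 𝓘(ℝ, E3) ∞ n V → ∀ y ∈ U, ∀ a b : E2,
      lor (fderiv ℝ s y a) (fderiv ℝ (chartNull n p) y b) =
        lor (dMap S (φ.symm y) (chartJ p y a)) (-dMap n (φ.symm y) (chartJ p y b), 0) := by
    intro n hn y hy a b
    rw [hs, fderiv_localRep hS.smooth p hy.1,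
      ← fderiv_chart p hy.1 (mdifferentiableAt_of_contMDiffOn h.isOpen hn hy.2)]
    exact congrArg _ (fderiv_neg_one hN.isOpen (contDiffOn_chart p hn) hy b)
  have hcenter : ∀ n : M → E3, ContMDiffOn (𝓡 2) 𝓘(ℝ, E3) ∞ n V → ∀ a b : E2,
      lor (fderiv ℝ s (φ p) a) (fderiv ℝ (chartNull n p) (φ p) b) =
        lor (dMap S p a) (-dMap n p b, 0) := by
    intro n hn a b
    rw [hs, ← fderiv_chart_center (hS.smooth.mdifferentiable (by simp) _),
      ← fderiv_chart_center (mdifferentiableAt_of_contMDiffOn h.isOpen hn hp)]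
    exact congrArg _ (fderiv_neg_one hN.isOpen (contDiffOn_chart p hn) hx₀ b)
  have hns := h.fst.1.smooth_n
  have hns' := h.snd.1.smooth_n
  -- The mixed discriminant on the constant coordinate vectors `v`, `w` of the single chart at `p`,
  -- written through `ds`, `dN`, `dN'` so that its continuity is visible. The shape operators
  -- themselves live in a different preferred chart at each point, and `chartJ` translates.
  set m : E2 → ℝ := fun y =>
    lor (fderiv ℝ s y v) (fderiv ℝ N y v) * lor (fderiv ℝ s y w) (fderiv ℝ N' y w) +
    lor (fderiv ℝ s y w) (fderiv ℝ N y w) * lor (fderiv ℝ s y v) (fderiv ℝ N' y v) -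
    2 * (lor (fderiv ℝ s y w) (fderiv ℝ N y v) * lor (fderiv ℝ s y w) (fderiv ℝ N' y v)) with hmdef
  have hm0 : m (φ p) ≠ 0 := by
    simp only [hmdef, hNdef, hNdef']
    rw [hcenter n hns, hcenter n hns, hcenter n hns, hcenter n' hns', hcenter n' hns',
      hcenter n' hns', hA.lor_dn, hA.lor_dn, hA.lor_dn, hA'.lor_dn, hA'.lor_dn, hA'.lor_dn]
    exact hm
  have hmcont : ContinuousOn m U := by
    have c : ∀ a b : E2, ContinuousOn (fun y => lor (fderiv ℝ s y a) (fderiv ℝ N y b)) U :=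
      fun a b => (contDiffOn_lor (contDiffOn_fderiv_apply hN.isOpen hN.smooth_s a)
        (contDiffOn_fderiv_apply hN.isOpen hN.smooth_N b)).continuousOn
    have c' : ∀ a b : E2, ContinuousOn (fun y => lor (fderiv ℝ s y a) (fderiv ℝ N' y b)) U :=
      fun a b => (contDiffOn_lor (contDiffOn_fderiv_apply hN.isOpen hN.smooth_s a)
        (contDiffOn_fderiv_apply hN.isOpen hN.smooth_N' b)).continuousOn
    exact (((c v v).mul (c' w w)).add ((c w w).mul (c' v v))).sub
      (continuousOn_const.mul ((c w v).mul (c' w v)))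
  -- A ball, since the constancy arguments for the reflection need a convex domain.
  obtain ⟨ε, hε, hball⟩ : ∃ ε > 0, Metric.ball (φ p) ε ⊆ {y | y ∈ U ∧ m y ≠ 0} := by
    refine Metric.mem_nhds_iff.mp ?_
    filter_upwards [hN.isOpen.mem_nhds hx₀,
      (hmcont.continuousAt (hN.isOpen.mem_nhds hx₀)).eventually_ne hm0] with y h1 h2
    exact ⟨h1, h2⟩
  set B := Metric.ball (φ p) ε with hBdef
  have hBU : B ⊆ U := fun y hy => (hball hy).1
  have hpropB : ∀ y ∈ B, ∃ (g : E2 →ₗ[ℝ] E2 →ₗ[ℝ] ℝ) (A A' : E2 →ₗ[ℝ] E2),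
      IsShapeOperator S f n (φ.symm y) g A ∧ IsShapeOperator S f' n' (φ.symm y) g A' ∧
      ∃ l : ℝ, l ≠ 0 ∧ ∀ x, A' x = l • A x := by
    intro y hy
    have hyU := hBU hy
    obtain ⟨g, A, A', hA, hA', -, -⟩ := h.exists_shapeOperators hS hyU.2
    refine ⟨g, A, A', hA, hA', ?_⟩
    obtain ⟨-, hl | hmix⟩ := commute_of_darboux hA hA' (hD _ hyU.2).1 (hD _ hyU.2).2
    · exact hl
    · exfalso
      refine (hball hy).2 ?_
      have h1 := hmix (chartJ p y v) (chartJ p y w)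
      simp only [hmdef, hNdef, hNdef']
      rw [hpair n hns y hyU, hpair n hns y hyU, hpair n hns y hyU, hpair n' hns' y hyU,
        hpair n' hns' y hyU, hpair n' hns' y hyU, hA.lor_dn, hA.lor_dn, hA.lor_dn, hA'.lor_dn,
        hA'.lor_dn, hA'.lor_dn]
      exact h1
  have hNB := hN.mono Metric.isOpen_ball hBU
  obtain ⟨R, b, hR, hRb⟩ := hNB.exists_isometry_of_shape_proportional (convex_ball _ _)
    (fun y hy => by
      obtain ⟨g, A, A', hA, hA', l, hl, hAl⟩ := hpropB y hy
      refine ⟨l, hl, fun a b => ?_⟩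
      rw [hNdef, hNdef', hpair n hns y (hBU hy), hpair n' hns' y (hBU hy), hA.lor_dn, hA'.lor_dn,
        hAl, map_smul, LinearMap.smul_apply, smul_eq_mul])
    (fun y hy b hb => by
      obtain ⟨g, A, A', hA, -, -⟩ := hpropB y hy
      have hinj := hA.injective (hD _ (hBU hy).2).2.1
      have h1 : A (chartJ p y b) = 0 := by
        refine hA.scalarProduct.eq_of_forall fun u => ?_
        obtain ⟨a, rfl⟩ := chartJ_surjective p (hBU hy).1 u
        rw [← hA.lor_dn, ← hpair n hns y (hBU hy), map_zero]
        exact hb a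
      refine chartJ_injective p (hBU hy).1 (hinj ?_)
      rw [h1, map_zero, map_zero])
    (Metric.mem_ball_self hε)
  have hV'open : IsOpen (φ.source ∩ φ ⁻¹' B) :=
    (continuousOn_extChartAt p).isOpen_inter_preimage (isOpen_extChartAt_source p)
      Metric.isOpen_ball
  have hback : ∀ q ∈ φ.source ∩ φ ⁻¹' B, φ.symm (φ q) = q := fun q hq => φ.left_inv hq.1
  have hV'V : φ.source ∩ φ ⁻¹' B ⊆ V := by
    intro q hq
    rw [← hback q hq]
    exact (hBU hq.2).2
  refine ⟨φ.source ∩ φ ⁻¹' B, f, n, f', n', ⟨p, mem_extChartAt_source p, Metric.mem_ball_self hε⟩,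
    h.mono hV'open hV'V, ⟨R, b, hR, fun q hq => ?_⟩, fun q hq => ?_⟩
  · obtain ⟨⟨c, hc, hcN⟩, hsb⟩ := hRb _ hq.2
    have e1 : N (φ q) = (-n q, 1) := by rw [hNdef, chartNull, hback q hq]
    have e2 : N' (φ q) = (-n' q, 1) := by rw [hNdef', chartNull, hback q hq]
    have e3 : s (φ q) = S q := congrArg S (hback q hq)
    rw [e1, e2] at hcN
    rw [e3] at hsb
    rw [contactLine_eq (h.fst.2 q (hV'V hq)), contactLine_eq (h.snd.2 q (hV'V hq))]
    -- The isometry fixes `S q` and scales the parameter of the contact line by `c ≠ 0`, so the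
    -- image is the whole line.
    have hline : ∀ t : ℝ, R (S q + t • ((-n q, 1) : Mink)) + b =
        S q + (t * c) • ((-n' q, 1) : Mink) := by
      intro t
      rw [map_add, map_smul, hcN, smul_smul]
      conv_rhs => rw [← hsb]
      abel
    ext u
    constructor
    · rintro ⟨_, ⟨t, rfl⟩, rfl⟩
      exact ⟨t * c, hline t⟩
    · rintro ⟨t, rfl⟩
      refine ⟨_, ⟨t / c, rfl⟩, ?_⟩
      simp only [hline]
      rw [div_mul_cancel₀ _ hc]
  · obtain ⟨g, A, A', hA, hA', l, hl, hAl⟩ := hpropB _ hq.2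
    rw [hback q hq] at hA hA'
    exact (sameOrientationAt_iff hA hA').mpr
      (det_mul_det_pos (hA.injective (hD q (hV'V hq)).2.1) hl hAl)

end Main

end LaguerreGeom

end

/-! ### The equivalence -/

theorem theorem2 {M : Type*} [TopologicalSpace M]
    [ChartedSpace (EuclideanSpace ℝ (Fin 2)) M] [IsManifold (𝓡 2) ∞ M]
    (S : M → LaguerreGeom.Mink)
    (hS : ContMDiff (𝓡 2) 𝓘(ℝ, LaguerreGeom.Mink) ∞ S)
    (hreg : LaguerreGeom.HasRegularEnvelopes S) :
    LaguerreGeom.IsNondegenerateDarboux S ↔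
      LaguerreGeom.IsSpacelikeImmersion S ∧ LaguerreGeom.IsFlat S ∧
        LaguerreGeom.HasFlatNormalBundle S := by
  constructor
  · rintro ⟨⟨hsp, hloc⟩, hnd⟩
    refine ⟨hsp, fun p => ?_, fun p => ?_⟩
    · obtain ⟨V, f, n, f', n', hp, hpair, hD⟩ := hloc p
      obtain ⟨g, A, A', hA, hA', hflat, -⟩ := hpair.exists_shapeOperators hsp hp
      refine hflat.mpr ?_
      by_contra! hcon
      obtain ⟨v, w, hvw⟩ := hcon
      exact hnd (LaguerreGeom.degenerateSomewhere_of_mixedDisc_ne_zero hsp hpair hD hp hA hA' hvw)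
    · obtain ⟨V, f, n, f', n', hp, hpair, hD⟩ := hloc p
      obtain ⟨g, A, A', hA, hA', -, hnflat⟩ := hpair.exists_shapeOperators hsp hp
      exact hnflat.mpr (LaguerreGeom.commute_of_darboux hA hA' (hD p hp).1 (hD p hp).2).1
  · rintro ⟨hsp, hflat, hnflat⟩
    -- Proved for an arbitrary pair of envelopes, because degeneracy may be witnessed by any pair;
    -- opposite orientation at a single point already refutes it.
    have key : ∀ (V : Set M) (f n f' n' : M → LaguerreGeom.E3),
        LaguerreGeom.IsEnvelopePair V S f n f' n' → ∀ q ∈ V,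
        (LaguerreGeom.PreservesCurvatureDirections f n f' n' q ∧
          LaguerreGeom.ConformalThirdForms n n' q) ∧
          ¬ LaguerreGeom.SameOrientationAt S n n' q := by
      intro V f n f' n' hpair q hq
      obtain ⟨g, A, A', hA, hA', hf, hnf⟩ := hpair.exists_shapeOperators hsp hq
      obtain ⟨h1, h2, h3⟩ := LaguerreGeom.darboux_of_mixedDisc_eq_zero hA hA'
        (hreg V f n hpair.isOpen hpair.fst q hq) (hreg V f' n' hpair.isOpen hpair.snd q hq)
        (hnf.mp (hnflat q)) (hf.mp (hflat q))
      refine ⟨⟨h1, h2⟩, fun ho => ?_⟩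
      exact absurd ((LaguerreGeom.sameOrientationAt_iff hA hA').mp ho) (not_lt.mpr h3.le)
    refine ⟨⟨hsp, fun p => ?_⟩, ?_⟩
    · obtain ⟨V, f, n, f', n', hp, hpair⟩ := LaguerreGeom.exists_envelopePair hsp p
      exact ⟨V, f, n, f', n', hp, hpair, fun q hq => (key V f n f' n' hpair q hq).1⟩
    · rintro ⟨V, f, n, f', n', ⟨q, hq⟩, hpair, -, ho⟩
      exact (key V f n f' n' hpair q hq).2 (ho q hq)
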